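/- Let $Y$ be the plane $\mathbb R^2=\mathbb C$, with coordinate $z=x+iy$, equipped with the conformal Riemannian metric $\rho(z)\,|dz|$, where $\rho(z)=1/y$ for $y\ge 1$ and $\rho(z)=e^{1-y}$ for $y<1$, and with the associated length metric and area measure $d\mathrm{area}=\rho^2\,dx\,dy$. Then: 1. $Y$ is simply connected and complete. 2. $Y$ is parabolic: there is no positive non-constant superharmonic function (with values in $(0,\infty]$) on $Y$; moreover, the identity map from $Y$ to $\mathbb C$ with its standard metric is a conformal equivalence. 3. The curvature measure of $Y$, i.e. the signed Radon measure $-\Delta\log\rho$ with the Laplacian in the sense of distributions, is absolutely continuous with respect to area, with a density $K$ that equals $-1$ where $y\ge1$ and $0$ where $y<1$; for $y\neq1$, $K$ is the Gaussian curvature $-\rho^{-2}\Delta\log\rho$. In particular $K\le 0$ everywhere, that is, $Y$ has nowhere positive curvature. 4. There is $\varepsilon>0$ such that for $a=i$ and every $r>0$ the open disc $D(a,r)$ of $Y$ with centre $a$ and radius $r$ has finite area and $$\int_{D(a,r)}K\,d\mathrm{area}<-\varepsilon\,\mathrm{area}\bigl(D(a,r)\bigr).$$ -/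

import Mathlib

open scoped ENNReal Manifold ContDiff Bundle
open Bundle

noncomputable section

/-- The density `ρ` of a conformal metric `ρ(z)|dz|` on the Riemann surface `ℂ`: a positive
continuous function. -/
structure ConformalDensity where
  /-- The density function. -/
  toFun : ℂ → ℝ
  pos : ∀ z, 0 < toFun z
  continuous : Continuous toFun

/-- The Riemannian surface `(ℂ, ρ(z)|dz|)`. As a set and as a smooth manifold it is `ℂ`; it
does not inherit the Euclidean metric of `ℂ`. -/
def ConformalPlane (_ρ : ConformalDensity) : Type := ℂ

namespace ConformalPlane

variable (ρ : ConformalDensity)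

instance : TopologicalSpace (ConformalPlane ρ) := inferInstanceAs (TopologicalSpace ℂ)

instance : T3Space (ConformalPlane ρ) := inferInstanceAs (T3Space ℂ)

instance : MeasurableSpace (ConformalPlane ρ) := inferInstanceAs (MeasurableSpace ℂ)

instance : BorelSpace (ConformalPlane ρ) := inferInstanceAs (BorelSpace ℂ)

instance : ChartedSpace ℂ (ConformalPlane ρ) := inferInstanceAs (ChartedSpace ℂ ℂ)

instance : IsManifold 𝓘(ℝ, ℂ) ∞ (ConformalPlane ρ) :=
  inferInstanceAs (IsManifold 𝓘(ℝ, ℂ) ∞ ℂ)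

theorem isVonNBounded_aux (c : ℝ) (hc : 0 < c) :
    Bornology.IsVonNBounded ℝ {v : ℂ | (c ^ 2 • (innerSL ℝ (E := ℂ))) v v < 1} := by
  refine (NormedSpace.isVonNBounded_ball ℝ ℂ c⁻¹).subset fun v hv ↦ ?_
  have h : (c * ‖v‖) ^ 2 < 1 := by
    rw [mul_pow, ← real_inner_self_eq_norm_sq]; exact hv
  have h' : c * ‖v‖ < 1 := by
    by_contra! h1
    nlinarith
  rw [mem_ball_zero_iff, inv_eq_one_div, lt_div_iff₀ hc]
  linarith

theorem continuous_aux (f : ℂ → ℝ) (hf : Continuous f) :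
    Continuous fun z : ℂ ↦ TotalSpace.mk' (ℂ →L[ℝ] ℂ →L[ℝ] ℝ)
      (E := fun z : ℂ ↦ TangentSpace 𝓘(ℝ, ℂ) z →L[ℝ] TangentSpace 𝓘(ℝ, ℂ) z →L[ℝ] ℝ)
      z (f z ^ 2 • (innerSL ℝ (E := ℂ)) : ℂ →L[ℝ] ℂ →L[ℝ] ℝ) := by
  have h : ContMDiff 𝓘(ℝ, ℂ) 𝓘(ℝ, ℝ) 0 (fun z ↦ f z ^ 2) := contMDiff_zero_iff.2 (hf.pow 2)
  exact (h.smul_section ((riemannianMetricVectorSpace ℂ).contMDiff.of_le (by simp))).continuous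

/-- The Riemannian metric `ρ(z)²|dz|²`: the inner product of two tangent vectors at `z` is
`ρ(z)²` times their Euclidean inner product. -/
def metric : ContinuousRiemannianMetric ℂ
    (fun z : ConformalPlane ρ ↦ TangentSpace 𝓘(ℝ, ℂ) z) where
  inner z := (ρ.toFun z ^ 2 • (innerSL ℝ (E := ℂ)) : ℂ →L[ℝ] ℂ →L[ℝ] ℝ)
  symm z v w := congrArg (ρ.toFun z ^ 2 * ·) (real_inner_comm (F := ℂ) w v)
  pos z v hv := mul_pos (pow_pos (ρ.pos z) 2)
    (real_inner_self_pos (F := ℂ).2 (show (v : ℂ) ≠ 0 from hv))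
  isVonNBounded z := isVonNBounded_aux (ρ.toFun z) (ρ.pos z)
  continuous := continuous_aux ρ.toFun ρ.continuous

instance : RiemannianBundle (fun z : ConformalPlane ρ ↦ TangentSpace 𝓘(ℝ, ℂ) z) :=
  ⟨(metric ρ).toRiemannianMetric⟩

/-- The length metric of `ρ(z)|dz|`: the distance of two points is the infimum of the lengths
of the `C¹` paths that join them. -/
instance : EMetricSpace (ConformalPlane ρ) :=
  .ofRiemannianMetric 𝓘(ℝ, ℂ) (ConformalPlane ρ)

variable {ρ}

/-- The standard coordinate `z = x + iy` of a point. -/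
def coord (p : ConformalPlane ρ) : ℂ := p

/-- The point with coordinate `z`. -/
def ofCoord (z : ℂ) : ConformalPlane ρ := z

variable (ρ) in
/-- The area measure `ρ(z)² dx dy`. -/
def area : MeasureTheory.Measure (ConformalPlane ρ) :=
  (MeasureTheory.volume : MeasureTheory.Measure ℂ).withDensity
    fun z ↦ ENNReal.ofReal (ρ.toFun z ^ 2)

/-- The open disc `D(a, r)` of radius `r` around `a`, for the length metric. -/
def disc (a : ConformalPlane ρ) (r : ℝ) : Set (ConformalPlane ρ) :=
  Metric.eball a (ENNReal.ofReal r)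

/-! ### Curvature -/

/-- The Gaussian curvature `-ρ⁻² Δ log ρ`, meaningful where `ρ` is twice differentiable. -/
def gaussianCurvature (p : ConformalPlane ρ) : ℝ :=
  -(ρ.toFun p.coord ^ 2)⁻¹ * Laplacian.laplacian (fun z ↦ Real.log (ρ.toFun z)) p.coord

/-- The curvature measure of `ρ(z)|dz|` is the signed Radon measure `-Δ log ρ`, with the
Laplacian in the sense of distributions; it coincides with `K` times area where `ρ` is smooth
with Gaussian curvature `K`. `IsCurvatureDensity K` says that this measure is absolutely
continuous with respect to area, with density `K`. -/
def IsCurvatureDensity (K : ConformalPlane ρ → ℝ) : Prop :=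
  MeasureTheory.LocallyIntegrable K (area ρ) ∧
    ∀ φ : ℂ → ℝ, ContDiff ℝ ∞ φ → HasCompactSupport φ →
      ∫ p, φ p.coord * K p ∂(area ρ) =
        -∫ z : ℂ, Real.log (ρ.toFun z) * Laplacian.laplacian φ z

/-! ### Parabolicity -/

/-- Superharmonic functions with values in `[0, ∞]`: lower semicontinuous, not identically `∞`,
and at each point at least the mean over every sufficiently small circle. Superharmonicity on a
Riemannian surface is a notion of its conformal structure, and `z` is a conformal coordinate. -/
def IsSuperharmonic (u : ConformalPlane ρ → ℝ≥0∞) : Prop :=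
  LowerSemicontinuous u ∧ (∃ p, u p ≠ ⊤) ∧
    ∀ p, ∃ R > 0, ∀ r : ℝ, 0 < r → r < R →
      (ENNReal.ofReal (2 * Real.pi))⁻¹ *
        ∫⁻ θ in Set.Ioc 0 (2 * Real.pi), u (ofCoord (circleMap p.coord r θ)) ≤ u p

variable (ρ) in
/-- There is no positive non-constant superharmonic function on the surface. -/
def IsParabolic : Prop :=
  ∀ u : ConformalPlane ρ → ℝ≥0∞, IsSuperharmonic u → (∀ p, 0 < u p) → ∀ p q, u p = u q

/-- `Φ` is a conformal equivalence of the surface with the Euclidean plane: its differential at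
each point `p` is a similarity from the tangent space at `p`, with the Riemannian inner product,
to `ℂ`. -/
def IsConformalEquiv (Φ : ConformalPlane ρ ≃ₘ⟮𝓘(ℝ, ℂ), 𝓘(ℝ, ℂ)⟯ ℂ) : Prop :=
  ∀ p : ConformalPlane ρ, IsConformalMap (mfderiv 𝓘(ℝ, ℂ) 𝓘(ℝ, ℂ) Φ p)

end ConformalPlane

/-- The density `1 / y` for `y ≥ 1` and `exp (1 - y)` for `y < 1`, where `z = x + iy`. -/
def glueDensity : ConformalDensity where
  toFun z := if 1 ≤ z.im then 1 / z.im else Real.exp (1 - z.im)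
  pos z := by
    split_ifs with h
    · exact one_div_pos.2 (by linarith)
    · exact Real.exp_pos _
  continuous := by
    have h1 : ContinuousOn (fun z : ℂ ↦ 1 / z.im) {z | 1 ≤ z.im} :=
      continuousOn_const.div Complex.continuous_im.continuousOn
        fun z (hz : 1 ≤ z.im) ↦ by linarith
    refine continuous_if_le continuous_const Complex.continuous_im h1
      (Continuous.continuousOn (by fun_prop)) fun z hz ↦ ?_
    simp [← hz]

/-- The surface `ℝ² = ℂ` with the metric `|dz| / y` on `y ≥ 1` and `exp (1 - y) |dz|` on
`y < 1`. -/
abbrev GluedSurface : Type := ConformalPlane glueDensity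

end

/-! The half `y ≥ 1` is a hyperbolic horoball. The half `y < 1` is flat: it is the universal cover
of the exterior of the unit disc through `z ↦ exp (1 + iz)`, whose derivative has modulus `exp (1 -
y)`. Along the seam `y = 1` the two formulas for `log ρ` agree to first order, so `log ρ` is `C¹`
with Lipschitz gradient and its distributional Laplacian has no mass on the seam
(`integral_comp_im_mul_laplacian`).

Distances are bounded below by functions whose local slope is at most `ρ` (`abs_sub_lt_of_edist_lt`)
and above by explicit paths. Two such functions, `arsinhFun` and `heightFun`, confine every disc to
a compact set, which gives completeness and finite area. Parabolicity depends only on the conformal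
structure, so it is a Liouville theorem for the Euclidean plane, proved with a logarithmic barrier
(`le_of_superharmonic`).

For the curvature inequality it suffices that the flat part of `D(i, r)` has area at most `C` times
that of the hyperbolic part (`exists_area_lowerPart_le`). For `r ≤ 4`, compare both with `r ^ 2`.
For larger `r`, climbing into the horoball lets the disc reach `|x|` of order `exp (r / 2)` along
the seam, so the hyperbolic area is at least of that order. In the flat part, `growthFun` bounds the
width by `exp (r / 2)` times a factor that decays fast enough with depth to beat the growth of the
density. -/

noncomputable section

open MeasureTheory Set Filter Topology

/-! ### Lengths of paths and functions of bounded slope -/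

namespace ConformalPlane

variable {ρ : ConformalDensity}

theorem norm_tangent (p : ConformalPlane ρ) (v : TangentSpace 𝓘(ℝ, ℂ) p) :
    ‖v‖ = ρ.toFun p.coord * ‖(show ℂ from v)‖ := by
  have h : inner ℝ v v = (ρ.toFun p.coord * ‖(show ℂ from v)‖) ^ 2 := by
    rw [mul_pow, ← real_inner_self_eq_norm_sq]
    rfl
  rw [norm_eq_sqrt_real_inner, h,
    Real.sqrt_sq (mul_nonneg (ρ.pos _).le (norm_nonneg _))]

theorem pathELength_eq (γ : ℝ → ℂ) (a b : ℝ) :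
    Manifold.pathELength 𝓘(ℝ, ℂ) (fun t ↦ ofCoord (ρ := ρ) (γ t)) a b =
      ∫⁻ t in Icc a b, ENNReal.ofReal (ρ.toFun (γ t) * ‖deriv γ t‖) := by
  rw [Manifold.pathELength_eq_lintegral_mfderiv_Icc]
  refine lintegral_congr fun t ↦ ?_
  rw [← ofReal_norm, norm_tangent]
  have h : mfderiv 𝓘(ℝ, ℝ) 𝓘(ℝ, ℂ) (M' := ℂ) γ t = fderiv ℝ γ t := mfderiv_eq_fderiv
  exact congrArg (fun L : ℝ →L[ℝ] ℂ ↦ ENNReal.ofReal (ρ.toFun (γ t) * ‖L 1‖)) h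

theorem edist_le_of_contDiff {γ : ℝ → ℂ} (hγ : ContDiff ℝ 1 γ) {c : ℝ}
    (hc : ∀ t ∈ Icc (0 : ℝ) 1, ρ.toFun (γ t) * ‖deriv γ t‖ ≤ c) :
    edist (ofCoord (ρ := ρ) (γ 0)) (ofCoord (γ 1)) ≤ ENNReal.ofReal c := by
  have h1 : edist (ofCoord (ρ := ρ) (γ 0)) (ofCoord (γ 1)) ≤
      Manifold.pathELength (M := ConformalPlane ρ) 𝓘(ℝ, ℂ) γ 0 1 := by
    change Manifold.riemannianEDist 𝓘(ℝ, ℂ) (M := ConformalPlane ρ) _ _ ≤ _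
    refine Manifold.riemannianEDist_le_pathELength ?_ rfl rfl zero_le_one
    have : ContMDiffOn 𝓘(ℝ, ℝ) 𝓘(ℝ, ℂ) 1 γ (Icc 0 1) := hγ.contMDiff.contMDiffOn
    exact this
  refine h1.trans ?_
  refine (pathELength_eq (ρ := ρ) γ 0 1).trans_le ?_
  calc _ ≤ ∫⁻ t in Icc (0 : ℝ) 1, ENNReal.ofReal c :=
        setLIntegral_mono measurable_const fun t ht ↦ ENNReal.ofReal_le_ofReal (hc t ht)
    _ = _ := by simp

theorem edist_le_segment {z w : ℂ} {c : ℝ}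
    (hc : ∀ t ∈ Icc (0 : ℝ) 1, ρ.toFun (z + t • (w - z)) * ‖w - z‖ ≤ c) :
    edist (ofCoord (ρ := ρ) z) (ofCoord w) ≤ ENNReal.ofReal c := by
  have hd (t : ℝ) : HasDerivAt (fun t : ℝ ↦ z + t • (w - z)) (w - z) t := by
    simpa using ((hasDerivAt_id t).smul_const (w - z)).const_add z
  have h := edist_le_of_contDiff (ρ := ρ) (γ := fun t : ℝ ↦ z + t • (w - z)) (c := c)
    (by fun_prop) (fun t ht ↦ by rw [(hd t).deriv]; exact hc t ht)
  simpa using h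

theorem exists_path_of_edist_lt {p q : ConformalPlane ρ} {r : ℝ≥0∞} (h : edist p q < r) :
    ∃ γ : ℝ → ℂ, ContDiff ℝ 1 γ ∧ γ 0 = p.coord ∧ γ 1 = q.coord ∧
      ∫⁻ t in Icc (0 : ℝ) 1, ENNReal.ofReal (ρ.toFun (γ t) * ‖deriv γ t‖) < r := by
  change Manifold.riemannianEDist 𝓘(ℝ, ℂ) (M := ConformalPlane ρ) _ _ < _ at h
  -- A path that is constant near its ends is `C¹` on all of `ℝ`, so no one-sided derivatives occur.
  obtain ⟨γ, h0, h1, hγ, hr, -⟩ :=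
    Manifold.exists_lt_locally_constant_of_riemannianEDist_lt h zero_lt_one
  refine ⟨γ, ?_, h0, h1, (pathELength_eq (ρ := ρ) γ 0 1).symm.trans_lt hr⟩
  have : ContMDiff 𝓘(ℝ, ℝ) 𝓘(ℝ, ℂ) (M' := ℂ) 1 γ := hγ
  exact this.contDiff

/-- `f` has local slope at most `c` at `z`. -/
def SlopeLE (f : ℂ → ℝ) (c : ℝ) (z : ℂ) : Prop :=
  ∀ ε > 0, ∀ᶠ w in 𝓝 z, |f w - f z| ≤ (c + ε) * ‖w - z‖

theorem SlopeLE.continuousAt {f : ℂ → ℝ} {c : ℝ} {z : ℂ} (h : SlopeLE f c z) :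
    ContinuousAt f z := by
  rw [ContinuousAt, tendsto_iff_dist_tendsto_zero]
  refine squeeze_zero' (Eventually.of_forall fun _ ↦ dist_nonneg) (h 1 one_pos) ?_
  have : Continuous fun w : ℂ ↦ (c + 1) * ‖w - z‖ := by fun_prop
  simpa using this.tendsto z

theorem SlopeLE.neg {f : ℂ → ℝ} {c : ℝ} {z : ℂ} (h : SlopeLE f c z) :
    SlopeLE (fun w ↦ -f w) c z := fun ε hε ↦ (h ε hε).mono fun w hw ↦ by
  rwa [neg_sub_neg, abs_sub_comm]

theorem SlopeLE.of_hasFDerivAt {f : ℂ → ℝ} {f' : ℂ →L[ℝ] ℝ} {c : ℝ} {z : ℂ}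
    (h : HasFDerivAt f f' z) (hc : ‖f'‖ ≤ c) : SlopeLE f c z := fun ε hε ↦ by
  filter_upwards [h.isLittleO.def hε] with w hw
  have h1 := f'.le_opNorm (w - z)
  have h2 : |f w - f z| ≤ |f w - f z - f' (w - z)| + |f' (w - z)| := by
    simpa using abs_add_le (f w - f z - f' (w - z)) (f' (w - z))
  rw [Real.norm_eq_abs] at hw h1
  nlinarith [norm_nonneg (w - z)]

/-- `f ∘ γ` need not be differentiable, since `f` may have a kink on the seam. Its right slopes at
`x` are still eventually below any number above `ρ (γ x) * ‖γ' x‖`, and this is enough for the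
one-sided mean value inequality. -/
theorem sub_le_of_slopeLE {f : ℂ → ℝ} (hf : ∀ z, SlopeLE f (ρ.toFun z) z)
    {γ : ℝ → ℂ} (hγ : ContDiff ℝ 1 γ) :
    f (γ 1) - f (γ 0) ≤ ∫ t in (0 : ℝ)..1, ρ.toFun (γ t) * ‖deriv γ t‖ := by
  have hcont : Continuous fun t ↦ ρ.toFun (γ t) * ‖deriv γ t‖ :=
    (ρ.continuous.comp hγ.continuous).mul (hγ.continuous_deriv le_rfl).norm
  have hB (x : ℝ) := intervalIntegral.integral_hasDerivAt_right
    (hcont.intervalIntegrable 0 x) (hcont.stronglyMeasurableAtFilter _ _) hcont.continuousAt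
  have hfc : Continuous f := continuous_iff_continuousAt.2 fun z ↦ (hf z).continuousAt
  have key := image_le_of_liminf_slope_right_le_deriv_boundary
    (f := fun t ↦ f (γ t) - f (γ 0)) (a := 0) (b := 1)
    (B := fun u ↦ ∫ t in (0 : ℝ)..u, ρ.toFun (γ t) * ‖deriv γ t‖)
    (B' := fun t ↦ ρ.toFun (γ t) * ‖deriv γ t‖)
    (by have := hγ.continuous; fun_prop) (by simp)
    (fun x _ ↦ (hB x).continuousAt.continuousWithinAt)
    (fun x _ ↦ (hB x).hasDerivWithinAt) ?_
  · simpa using key (right_mem_Icc.2 zero_le_one)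
  intro x _ r hr
  refine Eventually.frequently ?_
  have hd : HasDerivAt γ (deriv γ x) x := (hγ.differentiable one_ne_zero x).hasDerivAt
  have hpos := ρ.pos (γ x)
  obtain ⟨ε, hε, hεr⟩ : ∃ ε > 0, (ρ.toFun (γ x) + ε) * (‖deriv γ x‖ + ε) < r := by
    have hc : Continuous fun ε : ℝ ↦ (ρ.toFun (γ x) + ε) * (‖deriv γ x‖ + ε) := by fun_prop
    have h1 : ∀ᶠ ε in 𝓝[>] (0 : ℝ), (ρ.toFun (γ x) + ε) * (‖deriv γ x‖ + ε) < r :=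
      nhdsWithin_le_nhds (hc.continuousAt.eventually_lt_const (by simpa using hr))
    obtain ⟨ε, h, h'⟩ := (h1.and self_mem_nhdsWithin).exists
    exact ⟨ε, h', h⟩
  have h1 := nhdsWithin_le_nhds (s := Ioi x) (hγ.continuous.continuousAt.eventually (hf (γ x) ε hε))
  have h2 := nhdsWithin_le_nhds (s := Ioi x) (hd.isLittleO.def hε)
  filter_upwards [h1, h2, self_mem_nhdsWithin] with t ht1 ht2 (ht : x < t)
  refine lt_of_le_of_lt ?_ hεr
  have ht0 : 0 < t - x := sub_pos.2 ht
  rw [slope_def_field, div_le_iff₀ ht0]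
  have h3 : ‖γ t - γ x‖ ≤ (‖deriv γ x‖ + ε) * (t - x) := by
    have := norm_add_le (γ t - γ x - (t - x) • deriv γ x) ((t - x) • deriv γ x)
    rw [sub_add_cancel, norm_smul, Real.norm_of_nonneg ht0.le] at this
    have h4 : ‖γ t - γ x - (t - x) • deriv γ x‖ ≤ ε * (t - x) := by
      simpa [abs_of_pos ht0] using ht2
    linarith
  have := (le_abs_self _).trans ht1
  have h5 : (ρ.toFun (γ x) + ε) * ‖γ t - γ x‖ ≤
    (ρ.toFun (γ x) + ε) * ((‖deriv γ x‖ + ε) * (t - x)) :=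
    mul_le_mul_of_nonneg_left h3 (by positivity)
  linarith

/-- A function whose local slope is at most the density is `1`-Lipschitz for the length metric. -/
theorem abs_sub_lt_of_edist_lt {f : ℂ → ℝ} (hf : ∀ z, SlopeLE f (ρ.toFun z) z)
    {p q : ConformalPlane ρ} {r : ℝ} (h : edist p q < ENNReal.ofReal r) :
    |f q.coord - f p.coord| < r := by
  obtain ⟨γ, hγ, h0, h1, hr⟩ := exists_path_of_edist_lt h
  have hcont : Continuous fun t ↦ ρ.toFun (γ t) * ‖deriv γ t‖ :=
    (ρ.continuous.comp hγ.continuous).mul (hγ.continuous_deriv le_rfl).norm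
  have hnn (t : ℝ) : 0 ≤ ρ.toFun (γ t) * ‖deriv γ t‖ :=
    mul_nonneg (ρ.pos _).le (norm_nonneg _)
  rw [← ofReal_integral_eq_lintegral_ofReal hcont.continuousOn.integrableOn_Icc
    (Eventually.of_forall hnn), integral_Icc_eq_integral_Ioc,
    ← intervalIntegral.integral_of_le zero_le_one,
    ENNReal.ofReal_lt_ofReal_iff_of_nonneg
      (intervalIntegral.integral_nonneg zero_le_one fun t _ ↦ hnn t)] at hr
  have h2 := sub_le_of_slopeLE hf hγ
  have h3 := sub_le_of_slopeLE (fun z ↦ (hf z).neg) hγ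
  rw [h0, h1] at h2 h3
  rw [abs_lt]
  constructor <;> linarith

/-! ### Test functions on the glued surface -/

theorem SlopeLE.of_partial {f : ℂ → ℝ} {a b c : ℝ} {z : ℂ} {f' : ℂ →L[ℝ] ℝ}
    (h : HasFDerivAt f f' z) (ha : f' 1 = a) (hb : f' Complex.I = b) (hc : 0 ≤ c)
    (hab : a ^ 2 + b ^ 2 ≤ c ^ 2) : SlopeLE f c z := by
  refine .of_hasFDerivAt h (f'.opNorm_le_bound hc fun v ↦ ?_)
  have hv : f' v = a * v.re + b * v.im := by
    have : v = v.re • (1 : ℂ) + v.im • Complex.I := by simp [Complex.re_add_im]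
    rw [this, map_add, map_smul, map_smul, ha, hb]
    simp [mul_comm]
  have hn : ‖v‖ ^ 2 = v.re ^ 2 + v.im ^ 2 := by
    rw [Complex.sq_norm, Complex.normSq_apply]; ring
  rw [hv, Real.norm_eq_abs]
  refine abs_le_of_sq_le_sq ?_ (by positivity)
  rw [mul_pow, hn]
  nlinarith [sq_nonneg (a * v.im - b * v.re), sq_nonneg v.re, sq_nonneg v.im]

/-- The function equal to `f` on `y ≥ 1` and to `g` on `y < 1`. -/
def glue (f g : ℂ → ℝ) (z : ℂ) : ℝ := if 1 ≤ z.im then f z else g z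

theorem glue_of_le {f g : ℂ → ℝ} {z : ℂ} (h : 1 ≤ z.im) : glue f g z = f z := if_pos h

theorem glue_of_lt {f g : ℂ → ℝ} {z : ℂ} (h : z.im < 1) : glue f g z = g z := if_neg h.not_ge

theorem glueDensity_of_le {z : ℂ} (h : 1 ≤ z.im) : glueDensity.toFun z = 1 / z.im := if_pos h

theorem glueDensity_of_lt {z : ℂ} (h : z.im < 1) :
    glueDensity.toFun z = Real.exp (1 - z.im) := if_neg h.not_ge

/-- At a seam point `f` and `g` have the same value and the same slope bound `1`, so a nearby point
obeys the bound whichever side it lies on. -/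
theorem SlopeLE.glue {f g : ℂ → ℝ} (hf : ∀ z, 1 ≤ z.im → SlopeLE f (1 / z.im) z)
    (hg : ∀ z, z.im ≤ 1 → SlopeLE g (Real.exp (1 - z.im)) z)
    (hfg : ∀ z, z.im = 1 → f z = g z) (z : ℂ) :
    SlopeLE (glue f g) (glueDensity.toFun z) z := by
  intro ε hε
  rcases lt_trichotomy z.im 1 with h | h | h
  · filter_upwards [hg z h.le ε hε, Complex.continuous_im.continuousAt.eventually_lt_const h]
      with w hw hw'
    rwa [glue_of_lt hw', glue_of_lt h, glueDensity_of_lt h]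
  · filter_upwards [hg z h.le ε hε, hf z h.ge ε hε] with w hw hw'
    rw [glue_of_le h.ge, glueDensity_of_le h.ge]
    by_cases hz : 1 ≤ w.im
    · rwa [glue_of_le hz]
    · rw [glue_of_lt (not_le.1 hz), hfg z h]
      simpa [h] using hw
  · filter_upwards [hf z h.le ε hε, Complex.continuous_im.continuousAt.eventually_const_lt h]
      with w hw hw'
    rwa [glue_of_le hw'.le, glue_of_le h.le, glueDensity_of_le h.le]

theorem hasFDerivAt_re (z : ℂ) : HasFDerivAt Complex.re Complex.reCLM z :=
  Complex.reCLM.hasFDerivAt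

theorem hasFDerivAt_im (z : ℂ) : HasFDerivAt Complex.im Complex.imCLM z :=
  Complex.imCLM.hasFDerivAt

/-- A `1`-Lipschitz function on the glued surface which grows like the distance to `i`
on the horizontal line `y = 1`. -/
def growthFun : ℂ → ℝ :=
  glue (fun z ↦ Real.log (z.re ^ 2 + (z.im + 1) ^ 2) - Real.log z.im)
    (fun z ↦ Real.log (z.re ^ 2 + 4) + (Real.exp (1 - z.im) - 1) / 2)

/-- Above the seam the function is `2 log (2 cosh (d / 2))`, with `d` the hyperbolic distance to
`i`; its gradient has hyperbolic norm `tanh (d / 2) < 1`. Below, the two partial derivatives are at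
most `1 / 2` and `exp (1 - y) / 2` in absolute value, and `exp (1 - y) ≥ 1`. -/
theorem growthFun_slopeLE (z : ℂ) : SlopeLE growthFun (glueDensity.toFun z) z := by
  refine SlopeLE.glue (fun z hz ↦ ?_) (fun z hz ↦ ?_) (fun z hz ↦ ?_) z
  · have hy : 0 < z.im := by linarith
    have hQ : 0 < z.re ^ 2 + (z.im + 1) ^ 2 := by positivity
    have hd := ((((hasFDerivAt_re z).pow 2).add (((hasFDerivAt_im z).add_const 1).pow 2)).log
      hQ.ne').sub ((hasFDerivAt_im z).log hy.ne')
    refine .of_partial hd (a := 2 * z.re / (z.re ^ 2 + (z.im + 1) ^ 2))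
      (b := 2 * (z.im + 1) / (z.re ^ 2 + (z.im + 1) ^ 2) - 1 / z.im)
      (by simp; ring) (by simp; ring) (by positivity) ?_
    have : (2 * z.re / (z.re ^ 2 + (z.im + 1) ^ 2)) ^ 2 +
        (2 * (z.im + 1) / (z.re ^ 2 + (z.im + 1) ^ 2) - 1 / z.im) ^ 2 =
        (1 / z.im) ^ 2 - 4 / ((z.re ^ 2 + (z.im + 1) ^ 2) * z.im) := by
      field_simp
      ring
    rw [this]
    have : 0 < 4 / ((z.re ^ 2 + (z.im + 1) ^ 2) * z.im) := by positivity
    linarith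
  · have hQ : 0 < z.re ^ 2 + 4 := by positivity
    have hd := ((((hasFDerivAt_re z).pow 2).add_const 4).log hQ.ne').add
      (((((hasFDerivAt_im z).const_sub 1).exp).sub_const 1).mul_const (1 / 2))
    have hd' : HasFDerivAt
      (fun z : ℂ ↦ Real.log (z.re ^ 2 + 4) + (Real.exp (1 - z.im) - 1) / 2) _ z :=
      hd.congr_of_eventuallyEq (.of_forall fun w ↦ by simp [div_eq_mul_inv])
    have he : 1 ≤ Real.exp (1 - z.im) := Real.one_le_exp (by linarith)
    refine .of_partial hd' (a := 2 * z.re / (z.re ^ 2 + 4))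
      (b := -(Real.exp (1 - z.im) / 2))
      (by simp; ring) (by simp; ring) (by positivity) ?_
    have : (2 * z.re / (z.re ^ 2 + 4)) ^ 2 ≤ 1 / 4 := by
      rw [div_pow, div_le_div_iff₀ (by positivity) (by norm_num)]
      nlinarith [sq_nonneg (z.re ^ 2 - 4)]
    nlinarith
  · simp only [hz]
    norm_num

/-- A `1`-Lipschitz function on the glued surface that controls the real part. -/
def arsinhFun : ℂ → ℝ :=
  glue (fun z ↦ Real.arsinh (z.re / z.im)) (fun z ↦ Real.arsinh z.re)

/-- Above the seam this is the signed hyperbolic distance to the line `x = 0`, so its gradient has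
norm exactly `1 / y`. -/
theorem arsinhFun_slopeLE (z : ℂ) : SlopeLE arsinhFun (glueDensity.toFun z) z := by
  refine SlopeLE.glue (fun z hz ↦ ?_) (fun z hz ↦ ?_) (fun z hz ↦ ?_) z
  · have hy : 0 < z.im := by linarith
    have h1 : HasFDerivAt (fun z : ℂ ↦ z.re / z.im) _ z :=
      ((hasFDerivAt_re z).mul ((hasDerivAt_inv hy.ne').comp_hasFDerivAt z (hasFDerivAt_im z))).congr_of_eventuallyEq
        (.of_forall fun w ↦ by simp [div_eq_mul_inv])
    have hs : 0 < 1 + (z.re / z.im) ^ 2 := by positivity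
    refine .of_partial h1.arsinh (a := (√(1 + (z.re / z.im) ^ 2))⁻¹ * (1 / z.im))
      (b := (√(1 + (z.re / z.im) ^ 2))⁻¹ * (-z.re / z.im ^ 2)) (by simp)
      (by simp; ring) (by positivity) ?_
    rw [mul_pow, mul_pow, inv_pow, Real.sq_sqrt hs.le]
    apply le_of_eq
    field_simp
  · have he : 1 ≤ Real.exp (1 - z.im) := Real.one_le_exp (by linarith)
    have hs : 0 < 1 + z.re ^ 2 := by positivity
    refine .of_partial (hasFDerivAt_re z).arsinh (a := (√(1 + z.re ^ 2))⁻¹) (b := 0)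
      (by simp) (by simp) (by positivity) ?_
    have : (1 + z.re ^ 2)⁻¹ ≤ 1 := inv_le_one_of_one_le₀ (by nlinarith [sq_nonneg z.re])
    rw [inv_pow, Real.sq_sqrt hs.le]
    nlinarith
  · simp [hz]

/-- A `1`-Lipschitz function on the glued surface that controls the imaginary part. -/
def heightFun : ℂ → ℝ :=
  glue (fun z ↦ Real.log z.im) (fun z ↦ 1 - Real.exp (1 - z.im))

/-- On both sides this is the signed distance to the seam. -/
theorem heightFun_slopeLE (z : ℂ) : SlopeLE heightFun (glueDensity.toFun z) z := by
  refine SlopeLE.glue (fun z hz ↦ ?_) (fun z hz ↦ ?_) (fun z hz ↦ ?_) z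
  · have hy : 0 < z.im := by linarith
    exact .of_partial ((hasFDerivAt_im z).log hy.ne') (a := 0) (b := 1 / z.im)
      (by simp) (by simp) (by positivity) (by simp)
  · exact .of_partial ((((hasFDerivAt_im z).const_sub 1).exp).const_sub 1) (a := 0)
      (b := Real.exp (1 - z.im)) (by simp) (by simp) (by positivity) (by simp)
  · simp [hz]

/-- Above the seam `arsinhFun` controls only `x / y`; the height bound `y ≤ exp t` turns this into a
bound on `x`. -/
theorem abs_re_le {z : ℂ} {s t : ℝ} (hs : |arsinhFun z| ≤ s) (ht : |heightFun z| ≤ t) :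
    |z.re| ≤ Real.sinh s * Real.exp t := by
  have hs0 : 0 ≤ s := (abs_nonneg _).trans hs
  have ht0 : 0 ≤ t := (abs_nonneg _).trans ht
  have key (x : ℝ) (hx : |Real.arsinh x| ≤ s) : |x| ≤ Real.sinh s := by
    rw [← Real.sinh_arsinh x, Real.abs_sinh]
    exact Real.sinh_le_sinh.2 hx
  by_cases h : 1 ≤ z.im
  · rw [arsinhFun, glue_of_le h] at hs
    rw [heightFun, glue_of_le h] at ht
    have hy : 0 < z.im := by linarith
    have h1 := key _ hs
    rw [abs_div, abs_of_pos hy, div_le_iff₀ hy] at h1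
    refine h1.trans (mul_le_mul_of_nonneg_left ?_ (Real.sinh_nonneg_iff.2 hs0))
    rw [← Real.log_le_iff_le_exp hy]
    exact (le_abs_self _).trans ht
  · rw [arsinhFun, glue_of_lt (not_le.1 h)] at hs
    exact (key _ hs).trans
      (le_mul_of_one_le_right (Real.sinh_nonneg_iff.2 hs0) (Real.one_le_exp ht0))

theorem abs_im_le {z : ℂ} {t : ℝ} (ht : |heightFun z| ≤ t) : |z.im| ≤ Real.exp t + t := by
  have ht0 : 0 ≤ t := (abs_nonneg _).trans ht
  by_cases h : 1 ≤ z.im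
  · rw [heightFun, glue_of_le h] at ht
    have hy : 0 < z.im := by linarith
    have := (Real.log_le_iff_le_exp hy).1 ((le_abs_self _).trans ht)
    rw [abs_of_pos hy]
    linarith
  · rw [heightFun, glue_of_lt (not_le.1 h)] at ht
    have h1 := Real.add_one_le_exp (1 - z.im)
    have h2 := Real.add_one_le_exp t
    have := abs_le.1 ht
    rw [abs_le]
    constructor <;> linarith

/-! ### Relatively compact discs and completeness -/

theorem isCompact_setOf_abs_le (s t : ℝ) :
    IsCompact {z : ℂ | |arsinhFun z| ≤ s ∧ |heightFun z| ≤ t} := by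
  have h1 : Continuous arsinhFun :=
    continuous_iff_continuousAt.2 fun z ↦ (arsinhFun_slopeLE z).continuousAt
  have h2 : Continuous heightFun :=
    continuous_iff_continuousAt.2 fun z ↦ (heightFun_slopeLE z).continuousAt
  refine Metric.isCompact_of_isClosed_isBounded
    ((isClosed_le h1.abs continuous_const).inter (isClosed_le h2.abs continuous_const)) ?_
  refine (Metric.isBounded_closedBall (x := (0 : ℂ))
    (r := Real.sinh s * Real.exp t + (Real.exp t + t))).subset fun z hz ↦ ?_
  rw [mem_closedBall_zero_iff]
  exact (Complex.norm_le_abs_re_add_abs_im z).trans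
    (add_le_add (abs_re_le hz.1 hz.2) (abs_im_le hz.2))

/-- Discs of the glued surface are relatively compact. -/
theorem exists_isCompact_disc_subset (a : GluedSurface) (r : ℝ) :
    ∃ S : Set GluedSurface, IsCompact S ∧ disc a r ⊆ S := by
  refine ⟨_, isCompact_setOf_abs_le (|arsinhFun a.coord| + r) (|heightFun a.coord| + r),
    fun p hp ↦ ⟨?_, ?_⟩⟩
  · have := abs_sub_lt_of_edist_lt arsinhFun_slopeLE (p := a) (q := p) (by
      rw [edist_comm]; exact hp)
    exact le_add_of_sub_left_le ((abs_sub_abs_le_abs_sub _ _).trans this.le)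
  · have := abs_sub_lt_of_edist_lt heightFun_slopeLE (p := a) (q := p) (by
      rw [edist_comm]; exact hp)
    exact le_add_of_sub_left_le ((abs_sub_abs_le_abs_sub _ _).trans this.le)

theorem completeSpace_gluedSurface : CompleteSpace GluedSurface := by
  refine EMetric.complete_of_cauchySeq_tendsto fun u hu ↦ ?_
  obtain ⟨N, hN⟩ := EMetric.cauchySeq_iff'.1 hu (ENNReal.ofReal 1) (by simp)
  obtain ⟨S, hS, hsub⟩ := exists_isCompact_disc_subset (u N) 1
  obtain ⟨x, -, φ, hφ, hx⟩ := hS.tendsto_subseq (x := fun n ↦ u (n + N))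
    fun n ↦ hsub (hN (n + N) (by omega))
  exact ⟨x, tendsto_nhds_of_cauchySeq_of_subseq hu
    ((tendsto_add_atTop_nat N).comp hφ.tendsto_atTop) hx⟩

end ConformalPlane

/-! ### Liouville theorem for positive superharmonic functions -/

section Parabolic

open Real

/-- Expand around `c`: the cross term is real-affine in `z` and averages to its value at the centre,
while `‖z - c‖ ^ 2` is constantly `r ^ 2`. -/
theorem circleAverage_norm_sub_sq (p c : ℂ) (r : ℝ) :
    circleAverage (fun z ↦ ‖z - p‖ ^ 2) c r = ‖c - p‖ ^ 2 + r ^ 2 := by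
  have hid : circleAverage (fun z : ℂ ↦ z) c r = c :=
    (differentiable_id.diffContOnCl (s := Metric.ball c |r|)).circleAverage
  have hL := ((2 : ℝ) • innerSL ℝ (c - p)).circleAverage_comp_comm (f := fun z : ℂ ↦ z)
    (c := c) (R := r) continuous_id.continuousOn.circleIntegrable'
  rw [hid] at hL
  have h1 : EqOn (fun z ↦ ‖z - p‖ ^ 2)
      (fun z ↦ ((2 : ℝ) • innerSL ℝ (c - p)) z +
        (‖c - p‖ ^ 2 + r ^ 2 - ((2 : ℝ) • innerSL ℝ (c - p)) c)) (Metric.sphere c |r|) := by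
    intro z hz
    have hz' : ‖z - c‖ ^ 2 = r ^ 2 := by
      rw [mem_sphere_iff_norm.1 hz, sq_abs]
    have : z - p = (c - p) + (z - c) := by ring
    simp only
    rw [this, norm_add_sq_real, hz', inner_sub_right]
    simp only [_root_.smul_apply, innerSL_apply_apply, smul_eq_mul]
    ring
  rw [circleAverage_congr_sphere h1, circleAverage_fun_add, circleAverage_const]
  · have : circleAverage (fun z ↦ ((2 : ℝ) • innerSL ℝ (c - p)) z) c r = _ := hL
    rw [this]
    ring
  · exact ((2 : ℝ) • innerSL ℝ (c - p)).continuous.continuousOn.circleIntegrable'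
  · exact continuousOn_const.circleIntegrable'

theorem continuousOn_log_norm_sub (p : ℂ) :
    ContinuousOn (fun z : ℂ ↦ log ‖z - p‖) {p}ᶜ :=
  ContinuousOn.log (by fun_prop) fun z hz ↦ by simpa [sub_eq_zero] using hz

theorem circleAverage_log_sub_sq {p c : ℂ} {r : ℝ} (hr : 0 < r) (hrp : r < ‖c - p‖)
    (A B ε : ℝ) :
    circleAverage (fun z ↦ A + B * log ‖z - p‖ - ε * ‖z - p‖ ^ 2) c r =
      A + B * log ‖c - p‖ - ε * ‖c - p‖ ^ 2 - ε * r ^ 2 := by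
  have hsub : Metric.sphere c |r| ⊆ {p}ᶜ := by
    rintro z hz rfl
    rw [mem_sphere_iff_norm, norm_sub_rev, abs_of_pos hr] at hz
    exact hrp.ne' hz
  have i1 : CircleIntegrable (fun z ↦ B * log ‖z - p‖) c r :=
    (continuousOn_const.mul ((continuousOn_log_norm_sub p).mono hsub)).circleIntegrable'
  have i2 : CircleIntegrable (fun z ↦ ε * ‖z - p‖ ^ 2) c r :=
    ContinuousOn.circleIntegrable' (by fun_prop)
  have i0 : CircleIntegrable (fun _ : ℂ ↦ A) c r := continuousOn_const.circleIntegrable'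
  have hlog : circleAverage (fun z ↦ log ‖z - p‖) c r = log ‖c - p‖ := by
    have := circleAverage_log_norm_sub_const_eq_log_radius_add_posLog (c := c) (a := p) hr.ne'
    rw [this, posLog_eq_log, log_mul (inv_ne_zero hr.ne') (hr.trans hrp).ne', log_inv]
    · ring
    · rw [abs_of_nonneg (by positivity), inv_mul_eq_div, one_le_div hr]
      exact hrp.le
  have e1 : circleAverage (fun z ↦ B * log ‖z - p‖) c r = B * log ‖c - p‖ := by
    rw [← hlog]; exact circleAverage_fun_smul (𝕜 := ℝ)
  have e2 : circleAverage (fun z ↦ ε * ‖z - p‖ ^ 2) c r = ε * (‖c - p‖ ^ 2 + r ^ 2) := by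
    rw [← circleAverage_norm_sub_sq]; exact circleAverage_fun_smul (𝕜 := ℝ)
  have i01 : CircleIntegrable (fun z ↦ A + B * log ‖z - p‖) c r := i0.add i1
  rw [circleAverage_fun_sub i01 i2, circleAverage_fun_add i0 i1, circleAverage_const, e1, e2]
  ring

theorem lintegral_circle_ofReal {g : ℂ → ℝ} {c : ℂ} {r : ℝ}
    (hg : ContinuousOn g (Metric.sphere c |r|)) (h0 : ∀ z ∈ Metric.sphere c |r|, 0 ≤ g z) :
    (ENNReal.ofReal (2 * π))⁻¹ *
        ∫⁻ θ in Ioc 0 (2 * π), ENNReal.ofReal (g (circleMap c r θ)) =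
      ENNReal.ofReal (circleAverage g c r) := by
  have hpi : 0 < 2 * π := by positivity
  have hmem (θ : ℝ) : circleMap c r θ ∈ Metric.sphere c |r| := circleMap_mem_sphere' c r θ
  have hc : Continuous fun θ ↦ g (circleMap c r θ) :=
    hg.comp_continuous (continuous_circleMap c r) hmem
  rw [← ofReal_integral_eq_lintegral_ofReal
    (hc.continuousOn.integrableOn_Icc.mono_set Ioc_subset_Icc_self)
    (Eventually.of_forall fun θ ↦ h0 _ (hmem θ)), ← ENNReal.ofReal_inv_of_pos hpi,
    ← ENNReal.ofReal_mul (by positivity), ← intervalIntegral.integral_of_le hpi.le]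
  rfl

/-- If `u q < m < u p`, compare `u` on an annulus around `p` with a multiple of `log ‖z - p‖`, as in
the three circles theorem. As the outer radius tends to infinity the barrier at `q` tends to zero. A
small quadratic term makes the mean value inequality strict, so that an interior minimum of `u + g`
is impossible. -/
theorem le_of_superharmonic {u : ℂ → ℝ≥0∞} (hu : LowerSemicontinuous u)
    (hmean : ∀ p, ∃ R > 0, ∀ r : ℝ, 0 < r → r < R →
      (ENNReal.ofReal (2 * π))⁻¹ * ∫⁻ θ in Ioc 0 (2 * π), u (circleMap p r θ) ≤ u p)
    (p q : ℂ) : u p ≤ u q := by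
  by_contra! hlt
  have hq : u q ≠ ⊤ := hlt.ne_top
  obtain ⟨m', hm1, hm2⟩ := exists_between hlt
  obtain ⟨m, rfl⟩ : ∃ m : ℝ, m' = ENNReal.ofReal m := ⟨_, (ENNReal.ofReal_toReal hm2.ne_top).symm⟩
  set a := (u q).toReal
  have ha0 : 0 ≤ a := ENNReal.toReal_nonneg
  have ha : u q = ENNReal.ofReal a := (ENNReal.ofReal_toReal hq).symm
  have ham : a < m := by
    rw [ha] at hm1
    exact (ENNReal.ofReal_lt_ofReal_iff_of_nonneg ha0).1 hm1
  have hm0 : 0 < m := ha0.trans_lt ham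
  obtain ⟨δ, hδ, hball⟩ := Metric.nhds_basis_closedBall.eventually_iff.1 (hu p _ hm2)
  have hδq : δ < ‖q - p‖ := by
    by_contra! h
    exact hm1.not_gt (hball (mem_closedBall_iff_norm.2 h))
  set d := ‖q - p‖
  obtain ⟨R, hdR, hR⟩ : ∃ R > d, a + m * ((log d - log δ) / (log R - log δ)) < m := by
    have h1 : Tendsto (fun R ↦ a + m * ((log d - log δ) / (log R - log δ))) atTop
        (𝓝 (a + m * 0)) :=
      ((tendsto_const_nhds.div_atTop
        (tendsto_atTop_add_const_right _ (-log δ) tendsto_log_atTop)).const_mul m).const_add a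
    obtain ⟨R, h, h'⟩ := ((eventually_gt_atTop d).and
      (h1.eventually_lt_const (by simpa using ham))).exists
    exact ⟨R, h, h'⟩
  have hd0 : 0 < d := hδ.trans hδq
  have hR0 : 0 < R := hd0.trans hdR
  have hℓ : 0 < log R - log δ := sub_pos.2 (log_lt_log hδ (hδq.trans hdR))
  obtain ⟨ε, hε, hεR⟩ : ∃ ε > 0,
      a + m * ((log d - log δ) / (log R - log δ)) + ε * (R ^ 2 - d ^ 2) < m := by
    have hc : Continuous fun ε : ℝ ↦
      a + m * ((log d - log δ) / (log R - log δ)) + ε * (R ^ 2 - d ^ 2) := by fun_prop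
    have h1 : ∀ᶠ ε in 𝓝[>] (0 : ℝ),
        a + m * ((log d - log δ) / (log R - log δ)) + ε * (R ^ 2 - d ^ 2) < m :=
      nhdsWithin_le_nhds (hc.continuousAt.eventually_lt_const (by simpa using hR))
    obtain ⟨ε, h, h'⟩ := (h1.and self_mem_nhdsWithin).exists
    exact ⟨ε, h', h⟩
  set ℓ := log R - log δ
  set A := 1 - m / ℓ * log δ + ε * R ^ 2
  -- The summand `1` in `A` keeps `g` positive on the annulus, so that `ENNReal.ofReal` does not
  -- truncate it there.
  set g : ℂ → ℝ := fun z ↦ A + m / ℓ * log ‖z - p‖ - ε * ‖z - p‖ ^ 2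
  have hg_eq (z : ℂ) : g z = 1 + m / ℓ * (log ‖z - p‖ - log δ) + ε * (R ^ 2 - ‖z - p‖ ^ 2) := by
    simp only [g, A]; ring
  set S := Metric.closedBall p R \ Metric.ball p δ
  have hSmem (z : ℂ) : z ∈ S ↔ ‖z - p‖ ≤ R ∧ δ ≤ ‖z - p‖ := by
    simp [S, dist_eq_norm]
  have hScomp : IsCompact S := (isCompact_closedBall p R).diff Metric.isOpen_ball
  have hg1 (z : ℂ) (hz : z ∈ S) : 1 ≤ g z := by
    obtain ⟨h1, h2⟩ := (hSmem z).1 hz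
    have h3 : 0 ≤ log ‖z - p‖ - log δ := sub_nonneg.2 (log_le_log hδ h2)
    have h4 : 0 ≤ R ^ 2 - ‖z - p‖ ^ 2 := sub_nonneg.2 (pow_le_pow_left₀ (norm_nonneg _) h1 2)
    rw [hg_eq]
    have : 0 ≤ m / ℓ * (log ‖z - p‖ - log δ) := by positivity
    have : 0 ≤ ε * (R ^ 2 - ‖z - p‖ ^ 2) := by positivity
    linarith
  have hgc : ContinuousOn g S := by
    have : ContinuousOn (fun z : ℂ ↦ log ‖z - p‖) S :=
      (continuousOn_log_norm_sub p).mono fun z hz h ↦ by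
        have := ((hSmem z).1 hz).2
        rw [mem_singleton_iff.1 h, sub_self, norm_zero] at this
        linarith
    exact (continuousOn_const.add (continuousOn_const.mul this)).sub (by fun_prop)
  have hqS : q ∈ S := (hSmem q).2 ⟨hdR.le, hδq.le⟩
  have hlsc : LowerSemicontinuousOn (fun z ↦ u z + ENNReal.ofReal (g z)) S :=
    (hu.lowerSemicontinuousOn S).add
      (ENNReal.continuous_ofReal.comp_continuousOn hgc).lowerSemicontinuousOn
  obtain ⟨z, hzS, hzmin⟩ := hlsc.exists_isMinOn ⟨q, hqS⟩ hScomp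
  have hwz : u z + ENNReal.ofReal (g z) < ENNReal.ofReal (m + 1) := by
    refine (hzmin hqS).trans_lt ?_
    change u q + ENNReal.ofReal (g q) < _
    rw [ha, ← ENNReal.ofReal_add ha0 (by linarith [hg1 q hqS]),
      ENNReal.ofReal_lt_ofReal_iff (by linarith), hg_eq]
    have : m / ℓ * (log ‖q - p‖ - log δ) = m * ((log d - log δ) / ℓ) := by
      simp only [d]; ring
    rw [this]
    change a + (1 + _ + ε * (R ^ 2 - d ^ 2)) < _
    linarith
  obtain ⟨hzR, hzδ⟩ := (hSmem z).1 hzS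
  -- The minimum is below `m + 1`, because the value at `q` is. On the inner circle `u > m` and `g ≥
  -- 1`; on the outer circle `g = m + 1`. Hence the minimum point is interior.
  have hzδ' : δ < ‖z - p‖ := by
    refine lt_of_le_of_ne hzδ fun h ↦ hwz.not_ge ?_
    rw [ENNReal.ofReal_add hm0.le zero_le_one]
    exact add_le_add (hball (mem_closedBall_iff_norm.2 h.ge)).le
      (ENNReal.ofReal_le_ofReal (hg1 z hzS))
  have hzR' : ‖z - p‖ < R := by
    refine lt_of_le_of_ne hzR fun h ↦ hwz.not_ge ?_
    have : g z = m + 1 := by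
      rw [hg_eq, h, sub_self, mul_zero, add_zero]
      change 1 + m / ℓ * ℓ = m + 1
      rw [div_mul_cancel₀ _ hℓ.ne', add_comm]
    rw [this]
    exact le_add_self
  have huz : u z ≠ ⊤ := ((le_self_add).trans_lt hwz).ne_top
  obtain ⟨R₀, hR₀, hmz⟩ := hmean z
  obtain ⟨r, hr0, hr⟩ : ∃ r > 0, r < min R₀ (min (‖z - p‖ - δ) (R - ‖z - p‖)) :=
    exists_between (lt_min hR₀ (lt_min (sub_pos.2 hzδ') (sub_pos.2 hzR')))
  obtain ⟨hr1, hr2⟩ := lt_min_iff.1 hr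
  obtain ⟨hr2, hr3⟩ := lt_min_iff.1 hr2
  have hsph : Metric.sphere z |r| ⊆ S := by
    intro y hy
    rw [mem_sphere_iff_norm, abs_of_pos hr0] at hy
    have h1 : ‖y - p‖ ≤ ‖y - z‖ + ‖z - p‖ := norm_sub_le_norm_sub_add_norm_sub y z p
    have h2 : ‖z - p‖ ≤ ‖z - y‖ + ‖y - p‖ := norm_sub_le_norm_sub_add_norm_sub z y p
    rw [norm_sub_rev z y] at h2
    exact (hSmem y).2 ⟨by linarith, by linarith⟩
  have hpi : ENNReal.ofReal (2 * π) ≠ 0 := by simp [pi_pos]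
  have hav : circleAverage g z r = g z - ε * r ^ 2 :=
    circleAverage_log_sub_sq hr0 (by linarith) _ _ _
  have hgcirc : Continuous fun θ ↦ g (circleMap z r θ) :=
    hgc.comp_continuous (continuous_circleMap z r)
      fun θ ↦ hsph (circleMap_mem_sphere' z r θ)
  have key : u z + ENNReal.ofReal (g z) ≤ u z + ENNReal.ofReal (g z - ε * r ^ 2) := by
    calc u z + ENNReal.ofReal (g z)
        = (ENNReal.ofReal (2 * π))⁻¹ *
          ∫⁻ θ in Ioc 0 (2 * π), (u z + ENNReal.ofReal (g z)) := by
          rw [setLIntegral_const, volume_Ioc, sub_zero, mul_comm (u z + _), ← mul_assoc,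
            ENNReal.inv_mul_cancel hpi ENNReal.ofReal_ne_top, one_mul]
      _ ≤ (ENNReal.ofReal (2 * π))⁻¹ * ∫⁻ θ in Ioc 0 (2 * π),
          (u (circleMap z r θ) + ENNReal.ofReal (g (circleMap z r θ))) := by
          refine mul_le_mul_right (lintegral_mono fun θ ↦ ?_) _
          exact hzmin (hsph (circleMap_mem_sphere' z r θ))
      _ = (ENNReal.ofReal (2 * π))⁻¹ * (∫⁻ θ in Ioc 0 (2 * π), u (circleMap z r θ)) +
          (ENNReal.ofReal (2 * π))⁻¹ *
            ∫⁻ θ in Ioc 0 (2 * π), ENNReal.ofReal (g (circleMap z r θ)) := by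
          rw [lintegral_add_right _ hgcirc.measurable.ennreal_ofReal, mul_add]
      _ ≤ u z + ENNReal.ofReal (g z - ε * r ^ 2) := by
          rw [lintegral_circle_ofReal (hgc.mono hsph)
            (fun y hy ↦ zero_le_one.trans (hg1 y (hsph hy))), hav]
          exact add_le_add_left (hmz r hr0 hr1) _
  refine key.not_gt (ENNReal.add_lt_add_left huz ?_)
  rw [ENNReal.ofReal_lt_ofReal_iff (by linarith [hg1 z hzS])]
  have : 0 < ε * r ^ 2 := by positivity
  linarith

theorem ConformalPlane.isParabolic (ρ : ConformalDensity) : IsParabolic ρ := fun _ hu _ p q ↦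
  le_antisymm (le_of_superharmonic hu.1 hu.2.2 p q) (le_of_superharmonic hu.1 hu.2.2 q p)

end Parabolic

/-! ### Curvature measure -/

/-- The logarithm of the density of the glued surface as a function of `y`. -/
def glueLog (y : ℝ) : ℝ := if 1 ≤ y then -Real.log y else 1 - y

theorem log_glueDensity (z : ℂ) : Real.log (glueDensity.toFun z) = glueLog z.im := by
  change Real.log (if 1 ≤ z.im then 1 / z.im else Real.exp (1 - z.im)) = _
  unfold glueLog
  split_ifs <;> simp

theorem hasDerivAt_glueLog (y : ℝ) : HasDerivAt glueLog (-(max y 1)⁻¹) y := by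
  have h1 (hy : 1 ≤ y) : HasDerivAt (fun y ↦ -Real.log y) (-(max y 1)⁻¹) y := by
    rw [max_eq_left hy]
    exact (Real.hasDerivAt_log (by linarith)).neg
  have h2 (hy : y ≤ 1) : HasDerivAt (fun y : ℝ ↦ 1 - y) (-(max y 1)⁻¹) y := by
    rw [max_eq_right hy, inv_one]
    exact (hasDerivAt_id y).const_sub 1
  rcases lt_trichotomy y 1 with h | h | h
  · refine (h2 h.le).congr_of_eventuallyEq ?_
    filter_upwards [Iio_mem_nhds h] with x hx using if_neg (not_le.2 hx)
  · have a1 : HasDerivWithinAt glueLog (-(max y 1)⁻¹) (Ici 1) y :=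
      (h1 h.ge).hasDerivWithinAt.congr (fun x hx ↦ if_pos hx) (if_pos h.ge)
    have a2 : HasDerivWithinAt glueLog (-(max y 1)⁻¹) (Iic 1) y := by
      refine (h2 h.le).hasDerivWithinAt.congr (fun x (hx : x ≤ 1) ↦ ?_) ?_
      · rcases hx.lt_or_eq with hx | rfl
        · exact if_neg (not_le.2 hx)
        · simp [glueLog]
      · simp [glueLog, h]
    simpa using a2.union a1
  · refine (h1 h.le).congr_of_eventuallyEq ?_
    filter_upwards [Ioi_mem_nhds h] with x hx using if_pos (le_of_lt hx)

theorem hasDerivAt_neg_inv_max {y : ℝ} (hy : y ≠ 1) :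
    HasDerivAt (fun y : ℝ ↦ -(max y 1)⁻¹) (if 1 ≤ y then (y ^ 2)⁻¹ else 0) y := by
  rcases lt_or_gt_of_ne hy with h | h
  · rw [if_neg (not_le.2 h)]
    refine (hasDerivAt_const y (-1 : ℝ)).congr_of_eventuallyEq ?_
    filter_upwards [Iio_mem_nhds h] with x (hx : x < 1)
    rw [max_eq_right hx.le, inv_one]
  · rw [if_pos h.le]
    have := (hasDerivAt_inv (show y ≠ 0 by linarith)).neg
    rw [neg_neg] at this
    refine this.congr_of_eventuallyEq ?_
    filter_upwards [Ioi_mem_nhds h] with x (hx : 1 < x)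
    simp [max_eq_left hx.le]

theorem lipschitzWith_neg_inv_max : LipschitzWith 1 (fun y : ℝ ↦ -(max y 1)⁻¹) := by
  refine LipschitzWith.of_dist_le_mul fun x y ↦ ?_
  have hx : 1 ≤ max x 1 := le_max_right _ _
  have hy : 1 ≤ max y 1 := le_max_right _ _
  have h0 : 0 < max x 1 := by linarith
  have h0' : 0 < max y 1 := by linarith
  have h := abs_max_sub_max_le_abs x y 1
  rw [Real.dist_eq, Real.dist_eq, NNReal.coe_one, one_mul]
  refine le_trans ?_ h
  have : -(max x 1)⁻¹ - -(max y 1)⁻¹ = (max x 1 - max y 1) / (max x 1 * max y 1) := by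
    field_simp
    ring
  rw [this, abs_div]
  exact div_le_self (abs_nonneg _) ((one_le_mul_of_one_le_of_one_le hx hy).trans (le_abs_self _))

theorem lipschitzWith_glueLog : LipschitzWith 1 glueLog := by
  refine lipschitzWith_of_nnnorm_deriv_le (fun y ↦ (hasDerivAt_glueLog y).differentiableAt)
    fun y ↦ ?_
  rw [(hasDerivAt_glueLog y).deriv, ← NNReal.coe_le_coe, coe_nnnorm, norm_neg, norm_inv,
    NNReal.coe_one]
  exact inv_le_one_of_one_le₀ ((le_max_right y 1).trans (le_abs_self _))

theorem lipschitzWith_im : LipschitzWith 1 Complex.im :=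
  LipschitzWith.of_dist_le_mul fun z w ↦ by
    simpa [Real.dist_eq, dist_eq_norm] using Complex.abs_im_le_norm (z - w)

theorem hasFDerivAt_comp_im {h : ℝ → ℝ} {h' : ℝ} {z : ℂ} (hh : HasDerivAt h h' z.im) :
    HasFDerivAt (fun z : ℂ ↦ h z.im) (h' • Complex.imCLM) z :=
  hh.comp_hasFDerivAt z Complex.imCLM.hasFDerivAt

theorem lineDeriv_comp_im {h : ℝ → ℝ} {h' : ℝ} {z : ℂ} (hh : HasDerivAt h h' z.im) (v : ℂ) :
    lineDeriv ℝ (fun z : ℂ ↦ h z.im) z v = h' * v.im := by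
  have := (hasFDerivAt_comp_im hh).hasLineDerivAt v
  rw [this.lineDeriv]
  simp

theorem laplacian_complex (f : ℂ → ℝ) (z : ℂ) :
    Laplacian.laplacian f z = fderiv ℝ (fderiv ℝ f) z 1 1 +
      fderiv ℝ (fderiv ℝ f) z Complex.I Complex.I := by
  rw [InnerProductSpace.laplacian_eq_iteratedFDeriv_complexPlane]
  simp [iteratedFDeriv_two_apply]

theorem laplacian_comp_im {h h' : ℝ → ℝ} {h'' : ℝ} {z : ℂ}
    (hh : ∀ y, HasDerivAt h (h' y) y) (hh' : HasDerivAt h' h'' z.im) :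
    Laplacian.laplacian (fun z : ℂ ↦ h z.im) z = h'' := by
  have h1 : fderiv ℝ (fun z : ℂ ↦ h z.im) = fun z ↦ h' z.im • Complex.imCLM :=
    funext fun w ↦ (hasFDerivAt_comp_im (hh _)).fderiv
  rw [laplacian_complex, h1, ((hasFDerivAt_comp_im hh').smul_const Complex.imCLM).fderiv]
  simp

theorem laplacian_eq_lineDeriv {φ : ℂ → ℝ} (hφ : ContDiff ℝ ∞ φ) (z : ℂ) :
    Laplacian.laplacian φ z = lineDeriv ℝ (fun z ↦ fderiv ℝ φ z 1) z 1 +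
      lineDeriv ℝ (fun z ↦ fderiv ℝ φ z Complex.I) z Complex.I := by
  have hd : DifferentiableAt ℝ (fderiv ℝ φ) z :=
    (hφ.fderiv_right (m := ∞) (by simp)).differentiable (by simp) z
  have key (v : ℂ) : lineDeriv ℝ (fun z ↦ fderiv ℝ φ z v) z v = fderiv ℝ (fderiv ℝ φ) z v v := by
    have h1 : HasFDerivAt (fun z ↦ fderiv ℝ φ z v) _ z :=
      hd.hasFDerivAt.clm_apply (hasFDerivAt_const v z)
    rw [(h1.hasLineDerivAt v).lineDeriv]
    simp
  rw [laplacian_complex, key, key]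

theorem ae_im_ne (c : ℝ) : ∀ᵐ z : ℂ, z.im ≠ c := by
  rw [ae_iff]
  have h : {z : ℂ | ¬ z.im ≠ c} =
      Complex.measurableEquivRealProd ⁻¹' ((univ : Set ℝ) ×ˢ {c}) := by
    ext z; simp [Complex.measurableEquivRealProd]
  rw [h, Complex.volume_preserving_equiv_real_prod.measure_preimage
    (MeasurableSet.univ.prod (measurableSet_singleton c)).nullMeasurableSet,
    Measure.volume_eq_prod, Measure.prod_prod]
  simp

/-- Integrate by parts twice, each time with a Lipschitz factor: first `glueLog`, then its
derivative `-(max y 1)⁻¹`. Only the direction `I` contributes, and the seam, where the second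
derivative jumps, is a null set. -/
theorem integral_comp_im_mul_laplacian {φ : ℂ → ℝ} (hφ : ContDiff ℝ ∞ φ)
    (hs : HasCompactSupport φ) :
    ∫ z : ℂ, glueLog z.im * Laplacian.laplacian φ z =
      ∫ z : ℂ, (if 1 ≤ z.im then (z.im ^ 2)⁻¹ else 0) * φ z := by
  have hL : LipschitzWith (1 * 1) (fun z : ℂ ↦ glueLog z.im) :=
    lipschitzWith_glueLog.comp lipschitzWith_im
  have hL' : LipschitzWith (1 * 1) (fun z : ℂ ↦ -(max z.im 1)⁻¹) :=
    lipschitzWith_neg_inv_max.comp lipschitzWith_im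
  have hsm (v : ℂ) : ContDiff ℝ ∞ (fun z ↦ fderiv ℝ φ z v) :=
    (hφ.fderiv_right (m := ∞) (by simp)).clm_apply contDiff_const
  have hcs (v : ℂ) : HasCompactSupport (fun z ↦ fderiv ℝ φ z v) := hs.fderiv_apply ℝ v
  have hlip {g : ℂ → ℝ} (hg : ContDiff ℝ ∞ g) (hc : HasCompactSupport g) :
      ∃ D, LipschitzWith D g :=
    ContDiff.lipschitzWith_of_hasCompactSupport hc hg (by simp)
  have hcont (v : ℂ) : Integrable fun z ↦
      glueLog z.im * lineDeriv ℝ (fun z ↦ fderiv ℝ φ z v) z v := by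
    have he : (fun z ↦ lineDeriv ℝ (fun z ↦ fderiv ℝ φ z v) z v) =
        fun z ↦ fderiv ℝ (fun z ↦ fderiv ℝ φ z v) z v :=
      funext fun z ↦ ((hsm v).differentiable (by simp) z).lineDeriv_eq_fderiv
    have hc : Continuous fun z ↦ fderiv ℝ (fun z ↦ fderiv ℝ φ z v) z v :=
      ((hsm v).continuous_fderiv (by simp)).clm_apply continuous_const
    have hc' : HasCompactSupport fun z ↦ fderiv ℝ (fun z ↦ fderiv ℝ φ z v) z v :=
      (hcs v).fderiv_apply ℝ v
    rw [show (fun z ↦ glueLog z.im * lineDeriv ℝ (fun z ↦ fderiv ℝ φ z v) z v) =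
      fun z ↦ glueLog z.im * fderiv ℝ (fun z ↦ fderiv ℝ φ z v) z v from
      funext fun z ↦ by rw [← congrFun he z]]
    exact (hL.continuous.mul hc).integrable_of_hasCompactSupport hc'.mul_left
  have hparts (v : ℂ) :
      ∫ z, glueLog z.im * lineDeriv ℝ (fun z ↦ fderiv ℝ φ z v) z v =
        -(v.im * ∫ z, -(max z.im 1)⁻¹ * fderiv ℝ φ z v) := by
    obtain ⟨D, hD⟩ := hlip (hsm v) (hcs v)
    have h := hL.integral_lineDeriv_mul_eq (μ := volume) hD (hcs v) v
    simp only [lineDeriv_neg, neg_mul, integral_neg, lineDeriv_comp_im (hasDerivAt_glueLog _)] at h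
    rw [← integral_const_mul, ← integral_neg]
    simp only [mul_comm (glueLog _)]
    rw [← neg_inj.1 h]
    congr 1 with z
    ring
  have h2 : ∫ z, -(max z.im 1)⁻¹ * fderiv ℝ φ z Complex.I =
      -∫ z : ℂ, (if 1 ≤ z.im then (z.im ^ 2)⁻¹ else 0) * φ z := by
    obtain ⟨D, hD⟩ := hlip hφ hs
    have h := hL'.integral_lineDeriv_mul_eq (μ := volume) hD hs Complex.I
    have h1 : ∫ z, lineDeriv ℝ (fun z : ℂ ↦ -(max z.im 1)⁻¹) z Complex.I * φ z =
        ∫ z : ℂ, (if 1 ≤ z.im then (z.im ^ 2)⁻¹ else 0) * φ z := by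
      refine integral_congr_ae ?_
      filter_upwards [ae_im_ne 1] with z hz
      rw [lineDeriv_comp_im (hasDerivAt_neg_inv_max hz)]
      simp
    rw [← h1, h, ← integral_neg]
    congr 1 with z
    rw [lineDeriv_neg, (hφ.differentiable (by simp) z).lineDeriv_eq_fderiv]
    ring
  simp only [laplacian_eq_lineDeriv hφ, mul_add]
  rw [integral_add (hcont 1) (hcont Complex.I), hparts, hparts, h2]
  simp

namespace ConformalPlane

/-- The curvature of the glued surface. -/
def glueCurvature (p : GluedSurface) : ℝ := if 1 ≤ p.coord.im then -1 else 0

theorem gaussianCurvature_eq {p : GluedSurface} (hp : p.coord.im ≠ 1) :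
    gaussianCurvature p = glueCurvature p := by
  unfold gaussianCurvature glueCurvature
  simp only [log_glueDensity]
  rw [laplacian_comp_im hasDerivAt_glueLog (hasDerivAt_neg_inv_max hp)]
  split_ifs with h
  · have : p.coord.im ≠ 0 := by linarith
    rw [glueDensity_of_le h]
    field_simp
  · simp

instance (ρ : ConformalDensity) : IsLocallyFiniteMeasure (area ρ) :=
  IsLocallyFiniteMeasure.withDensity_ofReal (μ := (volume : Measure ℂ))
    (ρ.continuous.pow 2)

theorem measurable_glueCurvature : Measurable glueCurvature :=
  Measurable.ite (measurableSet_le measurable_const Complex.measurable_im)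
    measurable_const measurable_const

theorem integral_area (ρ : ConformalDensity) (f : ℂ → ℝ) :
    ∫ p : ConformalPlane ρ, f p.coord ∂(area ρ) = ∫ z : ℂ, ρ.toFun z ^ 2 * f z := by
  have h := integral_withDensity_eq_integral_toReal_smul (μ := (volume : Measure ℂ))
    (f := fun z ↦ ENNReal.ofReal (ρ.toFun z ^ 2))
    (by have := ρ.continuous.measurable; fun_prop) (by simp) f
  refine Eq.trans h ?_
  congr 1 with z
  rw [ENNReal.toReal_ofReal (sq_nonneg _), smul_eq_mul]

theorem isCurvatureDensity_glueCurvature : IsCurvatureDensity glueCurvature := by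
  refine ⟨?_, fun φ hφ hs ↦ ?_⟩
  · refine (locallyIntegrable_const (1 : ℝ)).mono
      measurable_glueCurvature.aestronglyMeasurable (.of_forall fun p ↦ ?_)
    unfold glueCurvature
    split_ifs <;> simp
  · refine (integral_area glueDensity fun z ↦ φ z * glueCurvature (ofCoord z)).trans ?_
    simp only [log_glueDensity]
    rw [integral_comp_im_mul_laplacian hφ hs, ← integral_neg]
    congr 1 with z
    unfold glueCurvature
    change glueDensity.toFun z ^ 2 * (φ z * if 1 ≤ z.im then -1 else 0) = _
    split_ifs with h
    · rw [glueDensity_of_le h, one_div, inv_pow]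
      ring
    · simp

end ConformalPlane

/-! ### Areas of the two parts of a disc -/

/-- The points of the plane with `y ∈ T` and `|x| ≤ w y`. -/
def sliced (T : Set ℝ) (w : ℝ → ℝ) : Set ℂ := {z | z.im ∈ T ∧ |z.re| ≤ w z.im}

theorem measurableSet_sliced {T : Set ℝ} (hT : MeasurableSet T) {w : ℝ → ℝ} (hw : Measurable w) :
    MeasurableSet (sliced T w) :=
  (Complex.measurable_im hT).inter
    (measurableSet_le Complex.measurable_re.abs (hw.comp Complex.measurable_im))

theorem setLIntegral_sliced {T : Set ℝ} (hT : MeasurableSet T) {w : ℝ → ℝ} (hw : Measurable w)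
    {c : ℝ → ℝ≥0∞} (hc : Measurable c) :
    ∫⁻ z in sliced T w, c z.im = ∫⁻ y in T, c y * ENNReal.ofReal (2 * w y) := by
  have hS := measurableSet_sliced hT hw
  have hf : Measurable ((sliced T w).indicator fun z ↦ c z.im) :=
    (hc.comp Complex.measurable_im).indicator hS
  rw [← lintegral_indicator hS, ← lintegral_indicator hT,
    ← Complex.volume_preserving_equiv_real_prod.symm.lintegral_comp hf,
    Measure.volume_eq_prod]
  refine (lintegral_prod_symm' _
    (hf.comp Complex.measurableEquivRealProd.symm.measurable)).trans ?_
  refine lintegral_congr fun y ↦ ?_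
  have h (x : ℝ) : (sliced T w).indicator (fun z ↦ c z.im)
      (Complex.measurableEquivRealProd.symm (x, y)) =
      T.indicator (fun y ↦ (Icc (-w y) (w y)).indicator (fun _ ↦ c y) x) y := by
    change (sliced T w).indicator (fun z ↦ c z.im) (Complex.mk x y) = _
    by_cases hy : y ∈ T <;> by_cases hx : |x| ≤ w y
    · rw [indicator_of_mem (show Complex.mk x y ∈ sliced T w from ⟨hy, hx⟩), indicator_of_mem hy,
        indicator_of_mem (show x ∈ Icc (-w y) (w y) from abs_le.1 hx)]
    · rw [indicator_of_notMem (show Complex.mk x y ∉ sliced T w from fun h ↦ hx h.2),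
        indicator_of_mem hy,
        indicator_of_notMem (show x ∉ Icc (-w y) (w y) from fun h ↦ hx (abs_le.2 h))]
    · rw [indicator_of_notMem (show Complex.mk x y ∉ sliced T w from fun h ↦ hy h.1),
        indicator_of_notMem hy]
    · rw [indicator_of_notMem (show Complex.mk x y ∉ sliced T w from fun h ↦ hy h.1),
        indicator_of_notMem hy]
  refine (lintegral_congr h).trans ?_
  by_cases hy : y ∈ T
  · simp only [indicator_of_mem hy]
    rw [lintegral_indicator measurableSet_Icc, setLIntegral_const, Real.volume_Icc]
    congr 2
    ring
  · simp [indicator_of_notMem hy]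

theorem setLIntegral_Iio_exp (a : ℝ) :
    ∫⁻ y in Iio a, ENNReal.ofReal (Real.exp (y - a)) = 1 := by
  have hi : IntegrableOn (fun y ↦ Real.exp (y - a)) (Iic a) := by
    simp only [Real.exp_sub]
    exact (integrableOn_exp_Iic a).div_const _
  rw [setLIntegral_congr Iio_ae_eq_Iic, ← ofReal_integral_eq_lintegral_ofReal hi
    (.of_forall fun _ ↦ (Real.exp_pos _).le)]
  simp only [Real.exp_sub, integral_div, integral_exp_Iic]
  rw [div_self (Real.exp_ne_zero _), ENNReal.ofReal_one]

/-- With `s = 1 - y` the depth, the left side is the density squared times the decay of the width of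
the disc. The bound is integrable over `y < 1`. The constant is `1728 = 12 ^ 3`, from cubing `t / 12
≤ exp (t / 12)`. -/
theorem exp_sq_mul_exp_neg_le (s : ℝ) :
    Real.exp s ^ 2 * Real.exp (-((Real.exp s - 1) / 4)) ≤
      1728 * Real.exp (1 / 4) * Real.exp (-s) := by
  set t := Real.exp s
  have ht : 0 < t := Real.exp_pos s
  have h1 : t / 12 ≤ Real.exp (t / 12) := by linarith [Real.add_one_le_exp (t / 12)]
  have h2 : (t / 12) ^ 3 ≤ Real.exp (t / 4) := by
    calc (t / 12) ^ 3 ≤ Real.exp (t / 12) ^ 3 := pow_le_pow_left₀ (by positivity) h1 3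
      _ = Real.exp (t / 4) := by rw [← Real.exp_nat_mul]; congr 1; push_cast; ring
  have h3 : Real.exp (-((t - 1) / 4)) = Real.exp (1 / 4) * (Real.exp (t / 4))⁻¹ := by
    rw [← Real.exp_neg, ← Real.exp_add]; congr 1; ring
  have h4 : Real.exp (-s) = t⁻¹ := Real.exp_neg s
  rw [h3, h4]
  have h5 : t ^ 3 ≤ 1728 * Real.exp (t / 4) := by nlinarith
  have he := Real.exp_pos (t / 4)
  calc t ^ 2 * (Real.exp (1 / 4) * (Real.exp (t / 4))⁻¹)
      = Real.exp (1 / 4) * t⁻¹ * (t ^ 3 * (Real.exp (t / 4))⁻¹) := by field_simp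
    _ ≤ Real.exp (1 / 4) * t⁻¹ * (1728 * Real.exp (t / 4) * (Real.exp (t / 4))⁻¹) := by gcongr
    _ = _ := by field_simp

namespace ConformalPlane

theorem area_apply (ρ : ConformalDensity) (S : Set ℂ) :
    area ρ S = ∫⁻ z : ℂ in S, ENNReal.ofReal (ρ.toFun z ^ 2) :=
  withDensity_apply' (μ := (volume : Measure ℂ)) _ S

/-- The centre `i`. -/
def centre : GluedSurface := ofCoord Complex.I

/-- Paths in the upper part: up, horizontally, and down. -/
theorem edist_centre_le {z : ℂ} (hz : 1 ≤ z.im) {s : ℝ} (hs : 0 ≤ s) :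
    edist (ofCoord z) centre ≤
      ENNReal.ofReal (2 * s + |z.re| * Real.exp (-s) + Real.log z.im) := by
  have vert (x s : ℝ) (hs : 0 ≤ s) :
      edist (ofCoord (ρ := glueDensity) ⟨x, 1⟩) (ofCoord ⟨x, Real.exp s⟩) ≤ ENNReal.ofReal s := by
    have hd (t : ℝ) : HasDerivAt (fun t : ℝ ↦ (x : ℂ) + (Real.exp (t * s) : ℝ) * Complex.I)
        ((Real.exp (t * s) * s : ℝ) * Complex.I) t := by
      have h1 : HasDerivAt (fun t ↦ Real.exp (t * s)) (Real.exp (t * s) * s) t := by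
        simpa using ((hasDerivAt_id t).mul_const s).exp
      exact (h1.ofReal_comp.mul_const Complex.I).const_add _
    have hexp : ContDiff ℝ 1 fun t : ℝ ↦ Real.exp (t * s) := by fun_prop
    have h := edist_le_of_contDiff (ρ := glueDensity)
      (γ := fun t : ℝ ↦ (x : ℂ) + (Real.exp (t * s) : ℝ) * Complex.I) (c := s)
      (contDiff_const.add ((Complex.ofRealCLM.contDiff.comp hexp).mul contDiff_const))
      (fun t ht ↦ by
        have him : ((x : ℂ) + (Real.exp (t * s) : ℝ) * Complex.I).im = Real.exp (t * s) := by
          simp [-Complex.ofReal_exp]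
        rw [(hd t).deriv, glueDensity_of_le (by
          rw [him]; exact Real.one_le_exp (mul_nonneg ht.1 hs)), him]
        rw [norm_mul, Complex.norm_I, mul_one, Complex.norm_real,
          Real.norm_of_nonneg (by positivity)]
        apply le_of_eq
        field_simp)
    convert h using 2 <;> congr 1 <;> apply Complex.ext <;>
      simp [-Complex.ofReal_exp]
  have horiz : edist (ofCoord (ρ := glueDensity) ⟨0, Real.exp s⟩) (ofCoord ⟨z.re, Real.exp s⟩) ≤
      ENNReal.ofReal (|z.re| * Real.exp (-s)) := by
    refine edist_le_segment fun t _ ↦ ?_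
    have h1 : (⟨z.re, Real.exp s⟩ : ℂ) - ⟨0, Real.exp s⟩ = (z.re : ℂ) := by
      apply Complex.ext <;> simp
    have h2 : ((⟨0, Real.exp s⟩ : ℂ) + t • (z.re : ℂ)).im = Real.exp s := by simp
    rw [h1, glueDensity_of_le (by rw [h2]; exact Real.one_le_exp hs), h2, Complex.norm_real,
      Real.norm_eq_abs, Real.exp_neg]
    apply le_of_eq
    field_simp
  have v1 := vert 0 s hs
  have v2 := vert z.re s hs
  have v3 := vert z.re (Real.log z.im) (Real.log_nonneg hz)
  rw [Real.exp_log (by linarith)] at v3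
  have hlog := Real.log_nonneg hz
  have hx : 0 ≤ |z.re| * Real.exp (-s) := by positivity
  rw [edist_comm]
  have hI : centre = ofCoord ⟨0, 1⟩ := rfl
  rw [hI]
  calc edist (ofCoord (ρ := glueDensity) ⟨0, 1⟩) (ofCoord z)
      ≤ edist (ofCoord (ρ := glueDensity) ⟨0, 1⟩) (ofCoord ⟨z.re, 1⟩) +
          edist (ofCoord (ρ := glueDensity) ⟨z.re, 1⟩) (ofCoord z) := edist_triangle _ _ _
    _ ≤ (edist (ofCoord (ρ := glueDensity) ⟨0, 1⟩) (ofCoord ⟨0, Real.exp s⟩) +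
          edist (ofCoord (ρ := glueDensity) ⟨0, Real.exp s⟩) (ofCoord ⟨z.re, Real.exp s⟩) +
          edist (ofCoord (ρ := glueDensity) ⟨z.re, Real.exp s⟩) (ofCoord ⟨z.re, 1⟩)) +
          edist (ofCoord (ρ := glueDensity) ⟨z.re, 1⟩) (ofCoord z) :=
        add_le_add_left (edist_triangle4 _ _ _ _) _
    _ ≤ (ENNReal.ofReal s + ENNReal.ofReal (|z.re| * Real.exp (-s)) + ENNReal.ofReal s) +
          ENNReal.ofReal (Real.log z.im) := by
        gcongr
        rwa [edist_comm]
    _ = _ := by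
        rw [← ENNReal.ofReal_add hs hx, ← ENNReal.ofReal_add (by positivity) hs,
          ← ENNReal.ofReal_add (by positivity) hlog]
        congr 1
        ring

/-- The part of a disc in `y < 1`. -/
def lowerPart (r : ℝ) : Set GluedSurface := disc centre r ∩ {p | p.coord.im < 1}

/-- The part of a disc in `y ≥ 1`. -/
def upperPart (r : ℝ) : Set GluedSurface := disc centre r ∩ {p | 1 ≤ p.coord.im}

theorem sub_lt_of_mem_disc {f : ℂ → ℝ} (hf : ∀ z, SlopeLE f (glueDensity.toFun z) z)
    {p : GluedSurface} {r : ℝ} (hp : p ∈ disc centre r) :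
    |f p.coord - f Complex.I| < r :=
  abs_sub_lt_of_edist_lt hf (p := centre) (q := p) (by rw [edist_comm]; exact hp)

theorem area_sliced_lower {T : Set ℝ} (hT : MeasurableSet T) (hT1 : T ⊆ Iio 1) {w : ℝ → ℝ}
    (hw : Measurable w) :
    area glueDensity (sliced T w) =
      ∫⁻ y in T, ENNReal.ofReal (Real.exp (1 - y) ^ 2) * ENNReal.ofReal (2 * w y) := by
  rw [← setLIntegral_sliced hT hw (by fun_prop)]
  refine (area_apply _ _).trans (setLIntegral_congr_fun (measurableSet_sliced hT hw) fun z hz ↦ ?_)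
  simp only [glueDensity_of_lt (hT1 hz.1)]

theorem area_lowerPart_le_sq {r : ℝ} (hr : 0 < r) (hr4 : r ≤ 4) :
    area glueDensity (lowerPart r) ≤ ENNReal.ofReal (2 * Real.exp 12 * r ^ 2) := by
  have hsub : lowerPart r ⊆ sliced (Ico (1 - r) 1) fun _ ↦ r * Real.exp 4 := by
    rintro p ⟨hp, hp1 : p.coord.im < 1⟩
    have h1 := sub_lt_of_mem_disc heightFun_slopeLE hp
    have h2 := sub_lt_of_mem_disc arsinhFun_slopeLE hp
    rw [heightFun, glue_of_lt hp1, glue_of_le (by simp)] at h1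
    rw [arsinhFun, glue_of_lt hp1, glue_of_le (by simp)] at h2
    simp only [Complex.I_im, Complex.I_re, Real.log_one, zero_div, Real.arsinh_zero,
      sub_zero] at h1 h2
    refine ⟨⟨?_, hp1⟩, ?_⟩
    · have := Real.add_one_le_exp (1 - p.coord.im)
      have := (abs_lt.1 h1).1
      change 1 - r ≤ p.coord.im
      linarith
    · have h3 : |p.coord.re| ≤ Real.sinh r := by
        rw [← Real.sinh_arsinh p.coord.re, Real.abs_sinh]
        exact Real.sinh_le_sinh.2 h2.le
      have h4 : Real.sinh r ≤ r * Real.exp 4 := by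
        have e1 := Real.add_one_le_exp (-r)
        have e2 : Real.exp r ≤ Real.exp 4 := Real.exp_le_exp.2 hr4
        have e3 : Real.exp r * Real.exp (-r) = 1 := by rw [← Real.exp_add]; simp
        have e4 : 1 ≤ Real.exp r := Real.one_le_exp hr.le
        rw [Real.sinh_eq]
        nlinarith [Real.exp_pos r]
      exact h3.trans h4
  refine (measure_mono hsub).trans ?_
  rw [area_sliced_lower measurableSet_Ico (fun y hy ↦ hy.2) measurable_const]
  calc _ ≤ ∫⁻ y in Ico (1 - r) 1, ENNReal.ofReal (Real.exp 8 * (2 * (r * Real.exp 4))) := by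
        refine setLIntegral_mono measurable_const fun y hy ↦ ?_
        rw [← ENNReal.ofReal_mul (by positivity)]
        refine ENNReal.ofReal_le_ofReal (mul_le_mul_of_nonneg_right ?_ (by positivity))
        rw [← Real.exp_nat_mul]
        refine Real.exp_le_exp.2 ?_
        push_cast
        linarith [hy.1]
    _ = _ := by
        rw [setLIntegral_const, Real.volume_Ico, ← ENNReal.ofReal_mul (by positivity)]
        congr 1
        rw [show (12 : ℝ) = 8 + 4 by norm_num, Real.exp_add]
        ring

theorem area_lowerPart_le_exp (r : ℝ) :
    area glueDensity (lowerPart r) ≤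
      ENNReal.ofReal (6912 * Real.exp (1 / 4) * Real.exp (r / 2)) := by
  set w : ℝ → ℝ := fun y ↦ 2 * (Real.exp (r / 2) * Real.exp (-((Real.exp (1 - y) - 1) / 4)))
  have hw : Measurable w := by fun_prop
  have hsub : lowerPart r ⊆ sliced (Iio 1) w := by
    rintro p ⟨hp, hp1 : p.coord.im < 1⟩
    refine ⟨hp1, ?_⟩
    have h1 := (abs_lt.1 (sub_lt_of_mem_disc growthFun_slopeLE hp)).2
    rw [growthFun, glue_of_lt hp1, glue_of_le (by simp)] at h1
    norm_num at h1
    change |p.coord.re| ≤ 2 * (Real.exp (r / 2) * Real.exp (-((Real.exp (1 - p.coord.im) - 1) / 4)))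
    rw [← Real.exp_add]
    set E := (Real.exp (1 - p.coord.im) - 1) / 2 with hE
    -- `growthFun` equals `log 4` at the centre and exceeds that by less than `r` on the disc.
    have h2 : Real.log (p.coord.re ^ 2 + 4) ≤ Real.log 4 + (r - E) := by linarith
    rw [Real.log_le_iff_le_exp (by positivity), Real.exp_add, Real.exp_log (by norm_num)] at h2
    refine abs_le_of_sq_le_sq ?_ (by positivity)
    rw [mul_pow, ← Real.exp_nat_mul]
    have : ((2 : ℕ) : ℝ) * (r / 2 + -((Real.exp (1 - p.coord.im) - 1) / 4)) = r - E := by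
      rw [hE]; push_cast; ring
    rw [this]
    linarith
  refine (measure_mono hsub).trans ?_
  rw [area_sliced_lower measurableSet_Iio subset_rfl hw]
  calc _ ≤ ∫⁻ y in Iio 1, ENNReal.ofReal (6912 * Real.exp (1 / 4) * Real.exp (r / 2)) *
          ENNReal.ofReal (Real.exp (y - 1)) := by
        refine lintegral_mono fun y ↦ ?_
        rw [← ENNReal.ofReal_mul (by positivity), ← ENNReal.ofReal_mul (by positivity)]
        refine ENNReal.ofReal_le_ofReal ?_
        have h := mul_le_mul_of_nonneg_left (exp_sq_mul_exp_neg_le (1 - y))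
          (show 0 ≤ 4 * Real.exp (r / 2) by positivity)
        rw [neg_sub] at h
        simp only [w]
        linarith
    _ = _ := by
        rw [lintegral_const_mul _ (by fun_prop), setLIntegral_Iio_exp, mul_one]

theorem le_area_upperPart {r s x b : ℝ} (hs : 0 ≤ s) (hb : 1 ≤ b) (hb2 : b ≤ 2) (hx : 0 ≤ x)
    (h : 2 * s + x * Real.exp (-s) + (b - 1) < r) :
    ENNReal.ofReal (x * (b - 1) / 2) ≤ area glueDensity (upperPart r) := by
  have hr : 0 < r := by
    have : 0 ≤ x * Real.exp (-s) := by positivity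
    linarith
  have hsub : sliced (Icc 1 b) (fun _ ↦ x) ⊆ upperPart r := by
    rintro z ⟨hz, hzx⟩
    refine ⟨(edist_centre_le hz.1 hs).trans_lt ?_, hz.1⟩
    rw [ENNReal.ofReal_lt_ofReal_iff hr]
    refine lt_of_le_of_lt ?_ h
    have h1 := Real.log_le_sub_one_of_pos (show 0 < z.im by linarith [hz.1])
    have h2 := hz.2
    gcongr
    linarith
  refine le_trans ?_ (measure_mono hsub)
  have hm := measurableSet_sliced (T := Icc 1 b) measurableSet_Icc
    (measurable_const (a := x))
  calc ENNReal.ofReal (x * (b - 1) / 2)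
      = ∫⁻ y in Icc 1 b, ENNReal.ofReal (1 / 4) * ENNReal.ofReal (2 * x) := by
        rw [setLIntegral_const, Real.volume_Icc, ← ENNReal.ofReal_mul (by positivity),
          ← ENNReal.ofReal_mul (by positivity)]
        congr 1
        ring
    _ = ∫⁻ z in sliced (Icc 1 b) (fun _ ↦ x), ENNReal.ofReal (1 / 4) :=
        (setLIntegral_sliced measurableSet_Icc measurable_const measurable_const).symm
    _ ≤ ∫⁻ z in sliced (Icc 1 b) (fun _ ↦ x), ENNReal.ofReal (glueDensity.toFun z ^ 2) := by
        refine setLIntegral_mono' hm fun z hz ↦ ENNReal.ofReal_le_ofReal ?_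
        have h1 : 1 ≤ z.im := hz.1.1
        have h2 : z.im ≤ 2 := hz.1.2.trans hb2
        rw [glueDensity_of_le h1, div_pow, one_pow]
        exact one_div_le_one_div_of_le (by positivity) (by nlinarith)
    _ = _ := (area_apply _ _).symm

theorem exists_area_lowerPart_le : ∃ C : ℝ, 0 < C ∧ ∀ r : ℝ, 0 < r →
    area glueDensity (lowerPart r) ≤ ENNReal.ofReal C * area glueDensity (upperPart r) ∧
      0 < area glueDensity (upperPart r) := by
  refine ⟨64 * Real.exp 12 + 27648 * Real.exp (1 / 4) * Real.exp 1, by positivity, fun r hr ↦ ?_⟩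
  set C := 64 * Real.exp 12 + 27648 * Real.exp (1 / 4) * Real.exp 1
  suffices ∃ l u : ℝ, 0 < u ∧ l ≤ C * u ∧ area glueDensity (lowerPart r) ≤ ENNReal.ofReal l ∧
      ENNReal.ofReal u ≤ area glueDensity (upperPart r) by
    obtain ⟨l, u, hu, hlu, hl, hu'⟩ := this
    refine ⟨hl.trans ((ENNReal.ofReal_le_ofReal hlu).trans ?_),
      (ENNReal.ofReal_pos.2 hu).trans_le hu'⟩
    rw [ENNReal.ofReal_mul (by positivity)]
    exact mul_le_mul_right hu' _
  rcases le_total r 4 with h | h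
  -- The upper part contains a rectangle of area at least `r ^ 2 / 32`, reached without climbing.
  · refine ⟨_, _, ?_, ?_, area_lowerPart_le_sq hr h,
      le_area_upperPart (s := 0) (x := r / 4) (b := 1 + r / 4) le_rfl (by linarith) (by linarith)
        (by positivity) (by rw [neg_zero, Real.exp_zero]; linarith)⟩
    · rw [add_sub_cancel_left]; positivity
    · have : 0 ≤ 27648 * Real.exp (1 / 4) * Real.exp 1 * (r / 4 * (r / 4) / 2) := by positivity
      simp only [C]
      rw [add_sub_cancel_left]
      linarith
  · have he := Real.exp_pos (r / 2 - 1)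
    -- Climbing `s = r / 2 - 1` makes the horizontal stretch cost at most `1`; the total `(r - 2) +
    -- 1 + 1 / 2` stays below `r`.
    refine ⟨_, _, ?_, ?_, area_lowerPart_le_exp r,
      le_area_upperPart (s := r / 2 - 1) (x := Real.exp (r / 2 - 1)) (b := 3 / 2) (by linarith)
        (by norm_num) (by norm_num) he.le
        (by rw [← Real.exp_add, add_neg_cancel, Real.exp_zero]; linarith)⟩
    · positivity
    · have : Real.exp (r / 2) = Real.exp 1 * Real.exp (r / 2 - 1) := by
        rw [← Real.exp_add]; congr 1; ring
      have h2 : 0 ≤ 64 * Real.exp 12 * (Real.exp (r / 2 - 1) * (3 / 2 - 1) / 2) := by positivity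
      simp only [C]
      rw [this]
      linarith

theorem area_disc_lt_top (r : ℝ) : area glueDensity (disc centre r) < ⊤ := by
  obtain ⟨S, hS, hsub⟩ := exists_isCompact_disc_subset centre r
  exact (measure_mono hsub).trans_lt hS.measure_lt_top

theorem exists_integral_glueCurvature_lt : ∃ ε : ℝ, 0 < ε ∧ ∀ r : ℝ, 0 < r →
    ∫ p in disc centre r, glueCurvature p ∂(area glueDensity) <
      -ε * (area glueDensity).real (disc centre r) := by
  obtain ⟨C, hC, h⟩ := exists_area_lowerPart_le
  -- The disc has area at most `C + 1` times that of its upper part; `C + 2` makes the inequality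
  -- strict.
  refine ⟨(C + 2)⁻¹, by positivity, fun r hr ↦ ?_⟩
  obtain ⟨h1, h2⟩ := h r hr
  have hup : MeasurableSet {p : GluedSurface | 1 ≤ p.coord.im} :=
    measurableSet_le measurable_const Complex.measurable_im
  have hfin := area_disc_lt_top r
  have hufin : area glueDensity (upperPart r) ≠ ⊤ :=
    ((measure_mono inter_subset_left).trans_lt hfin).ne
  have hK : glueCurvature = {p : GluedSurface | 1 ≤ p.coord.im}.indicator fun _ ↦ -1 := rfl
  have hint : ∫ p in disc centre r, glueCurvature p ∂(area glueDensity) =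
      -(area glueDensity).real (upperPart r) := by
    rw [hK, setIntegral_indicator hup, setIntegral_const, smul_eq_mul, mul_neg_one]
    rfl
  have hpos : 0 < (area glueDensity).real (upperPart r) := ENNReal.toReal_pos h2.ne' hufin
  have hlow : (area glueDensity).real (lowerPart r) ≤
      C * (area glueDensity).real (upperPart r) := by
    have := ENNReal.toReal_mono (ENNReal.mul_ne_top ENNReal.ofReal_ne_top hufin) h1
    rwa [ENNReal.toReal_mul, ENNReal.toReal_ofReal hC.le] at this
  have hsum : (area glueDensity).real (disc centre r) ≤
      (area glueDensity).real (upperPart r) + (area glueDensity).real (lowerPart r) := by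
    have : disc centre r = upperPart r ∪ lowerPart r := by
      rw [upperPart, lowerPart, ← inter_union_distrib_left]
      refine (inter_eq_left.2 fun p _ ↦ ?_).symm
      exact le_or_gt 1 p.coord.im
    conv_lhs => rw [this]
    exact measureReal_union_le _ _
  rw [hint, neg_mul, neg_lt_neg_iff, inv_mul_lt_iff₀ (by positivity)]
  linarith

/-! ### Topology and conformal type -/

theorem simplyConnectedSpace (ρ : ConformalDensity) : SimplyConnectedSpace (ConformalPlane ρ) :=
  inferInstanceAs (SimplyConnectedSpace ℂ)

/-- The identity map to the Euclidean plane. -/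
def coordDiffeo (ρ : ConformalDensity) : ConformalPlane ρ ≃ₘ⟮𝓘(ℝ, ℂ), 𝓘(ℝ, ℂ)⟯ ℂ where
  toFun := coord
  invFun := ofCoord
  left_inv _ := rfl
  right_inv _ := rfl
  contMDiff_toFun := (contMDiff_id : ContMDiff 𝓘(ℝ, ℂ) 𝓘(ℝ, ℂ) ∞ (id : ℂ → ℂ))
  contMDiff_invFun := (contMDiff_id : ContMDiff 𝓘(ℝ, ℂ) 𝓘(ℝ, ℂ) ∞ (id : ℂ → ℂ))

theorem isConformalEquiv_coordDiffeo (ρ : ConformalDensity) :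
    IsConformalEquiv (coordDiffeo ρ) := by
  intro p
  have hm : mfderiv 𝓘(ℝ, ℂ) 𝓘(ℝ, ℂ) (coordDiffeo ρ) p = ContinuousLinearMap.id ℝ ℂ :=
    mfderiv_id (I := 𝓘(ℝ, ℂ)) (M := ℂ)
  -- Scaling by `ρ` is an isometry from the Riemannian norm to the Euclidean one, and the
  -- differential of the identity is `ρ⁻¹` times it.
  let e : TangentSpace 𝓘(ℝ, ℂ) p →ₗ[ℝ] TangentSpace 𝓘(ℝ, ℂ) (coordDiffeo ρ p) :=
    (ρ.toFun p.coord • LinearMap.id : ℂ →ₗ[ℝ] ℂ)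
  refine ⟨(ρ.toFun p.coord)⁻¹, inv_ne_zero (ρ.pos _).ne', ⟨e, fun v ↦ ?_⟩, ?_⟩
  · rw [norm_tangent, norm_tangentSpace_vectorSpace]
    change ‖ρ.toFun p.coord • (show ℂ from v)‖ = _
    rw [norm_smul, Real.norm_of_nonneg (ρ.pos _).le]
  · refine hm.trans ?_
    refine ContinuousLinearMap.ext fun v : ℂ ↦ ?_
    change v = (ρ.toFun p.coord)⁻¹ • ρ.toFun p.coord • v
    rw [inv_smul_smul₀ (ρ.pos _).ne']

end ConformalPlane

end

theorem mainTheorem6 :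
    SimplyConnectedSpace GluedSurface ∧
    CompleteSpace GluedSurface ∧
    ConformalPlane.IsParabolic glueDensity ∧
    (∃ Φ : GluedSurface ≃ₘ⟮𝓘(ℝ, ℂ), 𝓘(ℝ, ℂ)⟯ ℂ,
      (∀ p, Φ p = p.coord) ∧ ConformalPlane.IsConformalEquiv Φ) ∧
    ∃ K : GluedSurface → ℝ,
      ConformalPlane.IsCurvatureDensity K ∧
      (∀ p, K p ≤ 0) ∧
      (∀ p, 1 ≤ p.coord.im → K p = -1) ∧
      (∀ p, p.coord.im < 1 → K p = 0) ∧
      (∀ p, p.coord.im ≠ 1 → ConformalPlane.gaussianCurvature p = K p) ∧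
      ∃ ε : ℝ, 0 < ε ∧ ∀ r : ℝ, 0 < r →
        ConformalPlane.area glueDensity
            (ConformalPlane.disc (ConformalPlane.ofCoord Complex.I) r) < ⊤ ∧
        ∫ p in ConformalPlane.disc (ConformalPlane.ofCoord Complex.I) r, K p
            ∂(ConformalPlane.area glueDensity) <
          -ε * (ConformalPlane.area glueDensity).real
            (ConformalPlane.disc (ConformalPlane.ofCoord Complex.I) r) := by
  open ConformalPlane in
  exact ⟨simplyConnectedSpace _, completeSpace_gluedSurface, isParabolic _,
    ⟨coordDiffeo _, fun _ ↦ rfl, isConformalEquiv_coordDiffeo _⟩, glueCurvature,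
    isCurvatureDensity_glueCurvature, fun p ↦ by unfold glueCurvature; split_ifs <;> norm_num,
    fun p hp ↦ if_pos hp, fun p hp ↦ if_neg hp.not_ge, fun p hp ↦ gaussianCurvature_eq hp,
    exists_integral_glueCurvature_lt.imp fun ε h ↦
      ⟨h.1, fun r hr ↦ ⟨area_disc_lt_top r, h.2 r hr⟩⟩⟩
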